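/- **Conventions.** All algebras are complex. A Banach $^*$-algebra is a (not necessarily unital) Banach algebra with an isometric involution. For a Banach $^*$-algebra $\mathfrak B$, a multiplier is a pair of bounded linear maps $b\mapsto ub$, $b\mapsto bu$ on $\mathfrak B$ with $(au)b=a(ub)$, $u(ab)=(ua)b$, $(ab)u=a(bu)$; $\mathcal{UM}(\mathfrak B)$ is the group of multipliers $u$ with $u^*u=uu^*=1$ and $\|ub\|\le\|b\|$, $\|bu\|\le\|b\|$ for all $b$; ${\rm Aut}_1(\mathfrak B)$ is the group of isometric $^*$-automorphisms of $\mathfrak B$, which act on multipliers by $\alpha(u)b=\alpha(u\,\alpha^{-1}(b))$, $b\,\alpha(u)=\alpha(\alpha^{-1}(b)\,u)$. A map from a topological space to a Banach space is strongly Borel if it is Borel and maps every compact set onto a separable set. A (measurable) twisted action $({\sf G},\alpha,\omega,\mathfrak B)$ consists of a Hausdorff locally compact group ${\sf G}$, a Banach $^*$-algebra $\mathfrak B$ and maps $\alpha:{\sf G}\to{\rm Aut}_1(\mathfrak B)$, $\omega:{\sf G}\times{\sf G}\to\mathcal{UM}(\mathfrak B)$ such that for every $b\in\mathfrak B$ the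 maps $x\mapsto\alpha_x(b)$, $(x,y)\mapsto\omega(x,y)b$ and $(x,y)\mapsto b\,\omega(x,y)$ are strongly Borel, and for all $x,y,z\in{\sf G}$, $b\in\mathfrak B$, $$\alpha_x(\omega(y,z))\,\omega(x,yz)=\omega(x,y)\,\omega(xy,z),\qquad \alpha_x(\alpha_y(b))\,\omega(x,y)=\omega(x,y)\,\alpha_{xy}(b),$$ $$\omega(x,{\sf e})=\omega({\sf e},y)=1,\qquad \alpha_{\sf e}={\rm id}.$$ Fix a left Haar measure ${\rm d}x$ on ${\sf G}$ and let $\Delta$ be the modular function, so that a Borel set $E$ satisfies $|Ex|=\Delta(x)|E|$ if it has finite measure. $L^1_{\alpha,\omega}({\sf G},\mathfrak B)$ is the space of classes of Bochner integrable functions $\Phi:{\sf G}\to\mathfrak B$ with norm $\int_{\sf G}\|\Phi(x)\|_{\mathfrak B}\,{\rm d}x$ and the operations $$\Phi*\Psi(x)=\int_{\sf G}\Phi(y)\,\alpha_y[\Psi(y^{-1}x)]\,\omega(y,y^{-1}x)\,{\rm d}y,\qquad \Phi^*(x)=\Delta(x^{-1})\,\omega(x,x^{-1})^*\,\alpha_x[\Phi(x^{-1})^*].$$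 Let $\mathfrak A\subset\mathfrak B$ be Banach $^*$-algebras, each with its own complete norm, $\mathfrak A$ being a $^*$-subalgebra of $\mathfrak B$ with continuous inclusion. $\mathfrak A$ is a differential subalgebra of $\mathfrak B$ if an identity of $\mathfrak A$, when there is one, is an identity of $\mathfrak B$, and there is a constant $C>0$ with $$\|ab\|_{\mathfrak A}\le C\big(\|a\|_{\mathfrak A}\|b\|_{\mathfrak B}+\|a\|_{\mathfrak B}\|b\|_{\mathfrak A}\big)\quad\text{for all }a,b\in\mathfrak A.$$ It is inverse-closed in $\mathfrak B$ if ${\rm Spec}_{\mathfrak A}(a)={\rm Spec}_{\mathfrak B}(a)$ for all $a\in\mathfrak A$, where the spectrum in an algebra without identity is the spectrum in its unitization. $\mathfrak A$ is stable under $({\sf G},\alpha,\omega,\mathfrak B)$ if the twisted action restricts to $\mathfrak A$: the automorphisms $\alpha_x$ and the left and right multiplications by $\omega(x,y)$ map $\mathfrak A$ into $\mathfrak A$, and their restrictions form a measurable twisted action $({\sf G},\alpha,\omega,\mathfrak A)$ on the Banach $^*$-algebra $\mathfrak A$. **Lemma 2.6.** Let $({\sf G},\alpha,\omega,\mathfrak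 B)$ be a measurable twisted action, and let $\mathfrak A$ be a dense differential subalgebra of $\mathfrak B$ that is stable under it. Then the operations above are well defined on $L^1_{\alpha,\omega}({\sf G},\mathfrak A)$ and $L^1_{\alpha,\omega}({\sf G},\mathfrak B)$ (the convolution integrals converge for almost every $x$, and the results are integrable), both are Banach $^*$-algebras, and $L^1_{\alpha,\omega}({\sf G},\mathfrak A)$, with its natural inclusion, is a dense differential subalgebra of $L^1_{\alpha,\omega}({\sf G},\mathfrak B)$. In particular, $L^1_{\alpha,\omega}({\sf G},\mathfrak A)$ is inverse-closed in $L^1_{\alpha,\omega}({\sf G},\mathfrak B)$. -/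

import Mathlib

open MeasureTheory
open scoped MultiplierAlgebra

/-- The axioms of a Banach `*`-algebra over `ℂ` with isometric involution, for a complex normed
space that carries a multiplication and a star operation. No unit is required. -/
structure IsBanachStarAlgebra (A : Type*) [NormedAddCommGroup A] [NormedSpace ℂ A]
    [Mul A] [Star A] : Prop where
  complete : CompleteSpace A
  mul_assoc : ∀ a b c : A, a * b * c = a * (b * c)
  add_mul : ∀ a b c : A, (a + b) * c = a * c + b * c
  mul_add : ∀ a b c : A, a * (b + c) = a * b + a * c
  smul_mul : ∀ (z : ℂ) (a b : A), (z • a) * b = z • (a * b)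
  mul_smul : ∀ (z : ℂ) (a b : A), a * (z • b) = z • (a * b)
  norm_mul_le : ∀ a b : A, ‖a * b‖ ≤ ‖a‖ * ‖b‖
  star_star : ∀ a : A, star (star a) = a
  star_mul : ∀ a b : A, star (a * b) = star b * star a
  star_add : ∀ a b : A, star (a + b) = star a + star b
  star_smul : ∀ (z : ℂ) (a : A), star (z • a) = (starRingEnd ℂ z) • star a
  norm_star : ∀ a : A, ‖star a‖ = ‖a‖

/-- `e` is a two-sided identity for the multiplication of `A`. -/
def IsIdentity {A : Type*} [Mul A] (e : A) : Prop :=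
  ∀ a : A, e * a = a ∧ a * e = a

/-- `A`, with its own norm, is a differential subalgebra of `B`. The inclusion of the Banach
`*`-subalgebra `A` into `B` is the map `ι`, an injective continuous `*`-homomorphism. -/
structure IsDifferentialSubalgebra {A B : Type*}
    [NormedAddCommGroup A] [NormedSpace ℂ A] [Mul A] [Star A]
    [NormedAddCommGroup B] [NormedSpace ℂ B] [Mul B] [Star B] (ι : A →L[ℂ] B) : Prop where
  banach_left : IsBanachStarAlgebra A
  banach_right : IsBanachStarAlgebra B
  injective : Function.Injective ι
  map_mul : ∀ a b : A, ι (a * b) = ι a * ι b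
  map_star : ∀ a : A, ι (star a) = star (ι a)
  map_identity : ∀ e : A, IsIdentity e → IsIdentity (ι e)
  norm_mul_le : ∃ C : ℝ, 0 < C ∧
    ∀ a b : A, ‖a * b‖ ≤ C * (‖a‖ * ‖ι b‖ + ‖ι a‖ * ‖b‖)

/-- The spectrum of an element of a complex algebra: taken in `A` itself if `A` has an identity,
and in the unitization `ℂ ⊕ A` if `A` has none. -/
def algSpectrum {A : Type*} [NormedAddCommGroup A] [NormedSpace ℂ A] [Mul A] (a : A) : Set ℂ :=
  {z | (∀ e : A, IsIdentity e →
          ¬ ∃ b : A, (z • e - a) * b = e ∧ b * (z • e - a) = e) ∧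
       ((¬ ∃ e : A, IsIdentity e) →
          ¬ ∃ u : Unitization ℂ A,
            ((Unitization.inl z : Unitization ℂ A) - (a : Unitization ℂ A)) * u = 1 ∧
            u * ((Unitization.inl z : Unitization ℂ A) - (a : Unitization ℂ A)) = 1)}

/-- `A` is inverse-closed (spectrally invariant) in `B`, the inclusion being `ι`. -/
def IsInverseClosed {A B : Type*}
    [NormedAddCommGroup A] [NormedSpace ℂ A] [Mul A]
    [NormedAddCommGroup B] [NormedSpace ℂ B] [Mul B] (ι : A →L[ℂ] B) : Prop :=
  ∀ a : A, algSpectrum a = algSpectrum (ι a)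

/-- A Borel map whose values on each compact set form a separable set, that is, a Borel map which
is on every compact set a pointwise limit of simple Borel functions. -/
def IsStronglyBorel {X E : Type*} [TopologicalSpace X] [TopologicalSpace E] (f : X → E) : Prop :=
  @Measurable X E (borel X) (borel E) f ∧
    ∀ K : Set X, IsCompact K → TopologicalSpace.IsSeparable (f '' K)

section TwistedAction

variable {B : Type*} [NonUnitalNormedRing B] [StarRing B] [NormedStarGroup B] [NormedSpace ℂ B]
  [IsScalarTower ℂ B B] [SMulCommClass ℂ B B] [StarModule ℂ B]

/-- The elements of the unitary group of the multiplier algebra. A multiplier `u` is a pair of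
maps `u.fst : b ↦ u b` and `u.snd : b ↦ b u` with `(a u) b = a (u b)`. The rules
`u (a b) = (u a) b` and `(a b) u = a (b u)` follow from this when `B` has no annihilators, and
are part of the definition of a multiplier in general. As the automorphisms of `B`, the
unitary multipliers are taken to be of norm one (automatic in a `C*`-algebra). -/
structure IsUnitaryMultiplier (u : 𝓜(ℂ, B)) : Prop where
  fst_mul : ∀ a b : B, u.fst (a * b) = u.fst a * b
  snd_mul : ∀ a b : B, u.snd (a * b) = a * u.snd b
  star_mul_self : star u * u = 1
  mul_star_self : u * star u = 1
  norm_le_one : ‖u‖ ≤ 1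

/-- An isometric `*`-automorphism as a continuous linear map. -/
noncomputable def isometricAutCLM (L : B ≃⋆ₐ[ℂ] B) (hL : ∀ b, ‖L b‖ = ‖b‖) : B →L[ℂ] B :=
  LinearMap.mkContinuous
    { toFun := L, map_add' := map_add L, map_smul' := fun z b => map_smul L z b } 1
    (fun b => by simp [hL])

/-- The extension of an isometric `*`-automorphism `L` of `B` to the multiplier algebra:
`L(m) b = L (m (L⁻¹ b))` and `b L(m) = L ((L⁻¹ b) m)`. -/
noncomputable def multiplierMap (L : B ≃⋆ₐ[ℂ] B) (hL : ∀ b, ‖L b‖ = ‖b‖) (m : 𝓜(ℂ, B)) :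
    𝓜(ℂ, B) where
  fst := (isometricAutCLM L hL).comp
    (m.fst.comp (isometricAutCLM L.symm (fun b => by simpa using (hL (L.symm b)).symm)))
  snd := (isometricAutCLM L hL).comp
    (m.snd.comp (isometricAutCLM L.symm (fun b => by simpa using (hL (L.symm b)).symm)))
  central := fun x y => by
    have h := congrArg L (m.central (L.symm x) (L.symm y))
    simpa [isometricAutCLM] using h

end TwistedAction

/-- A measurable twisted action `(G, α, ω, B)` of a topological group on a Banach `*`-algebra:
isometric `*`-automorphisms `α_x` and unitary multipliers `ω(x, y)`, strongly Borel, such that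
`α_x(ω(y, z)) ω(x, y z) = ω(x, y) ω(x y, z)`, `α_x(α_y(b)) ω(x, y) = ω(x, y) α_{xy}(b)`,
`ω(x, 1) = ω(1, y) = 1` and `α_1 = id`. -/
structure TwistedAction (G B : Type*) [Group G] [TopologicalSpace G]
    [NonUnitalNormedRing B] [StarRing B] [NormedStarGroup B] [NormedSpace ℂ B]
    [IsScalarTower ℂ B B] [SMulCommClass ℂ B B] [StarModule ℂ B] where
  α : G → (B ≃⋆ₐ[ℂ] B)
  ω : G → G → 𝓜(ℂ, B)
  norm_α : ∀ x b, ‖α x b‖ = ‖b‖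
  unitary_ω : ∀ x y, IsUnitaryMultiplier (ω x y)
  borel_α : ∀ b, IsStronglyBorel (fun x => α x b)
  borel_ω_fst : ∀ b, IsStronglyBorel (fun p : G × G => (ω p.1 p.2).fst b)
  borel_ω_snd : ∀ b, IsStronglyBorel (fun p : G × G => (ω p.1 p.2).snd b)
  cocycle : ∀ x y z,
    multiplierMap (α x) (norm_α x) (ω y z) * ω x (y * z) = ω x y * ω (x * y) z
  twist : ∀ x y b, (ω x y).snd (α x (α y b)) = (ω x y).fst (α (x * y) b)
  ω_one_right : ∀ x, ω x 1 = 1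
  ω_one_left : ∀ y, ω 1 y = 1
  α_one : ∀ b, α 1 b = b

namespace TwistedAction

section Stable

variable {G A B : Type*} [Group G] [TopologicalSpace G]
  [NonUnitalNormedRing A] [StarRing A] [NormedStarGroup A] [NormedSpace ℂ A]
  [IsScalarTower ℂ A A] [SMulCommClass ℂ A A] [StarModule ℂ A]
  [NonUnitalNormedRing B] [StarRing B] [NormedStarGroup B] [NormedSpace ℂ B]
  [IsScalarTower ℂ B B] [SMulCommClass ℂ B B] [StarModule ℂ B]

/-- The subalgebra `A` of `B` (with inclusion `ι`) is stable under the twisted action `T` on `B`,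
and `S` is the twisted action on `A` to which `T` restricts. -/
structure RestrictsTo (T : TwistedAction G B) (ι : A →L[ℂ] B) (S : TwistedAction G A) :
    Prop where
  map_α : ∀ x a, ι (S.α x a) = T.α x (ι a)
  map_ω_fst : ∀ x y a, ι ((S.ω x y).fst a) = (T.ω x y).fst (ι a)
  map_ω_snd : ∀ x y a, ι ((S.ω x y).snd a) = (T.ω x y).snd (ι a)

end Stable

section L1

variable {G B : Type*} [Group G] [TopologicalSpace G] [IsTopologicalGroup G]
  [LocallyCompactSpace G] [MeasurableSpace G] [BorelSpace G]
  [NonUnitalNormedRing B] [StarRing B] [NormedStarGroup B] [NormedSpace ℂ B]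
  [IsScalarTower ℂ B B] [SMulCommClass ℂ B B] [StarModule ℂ B]

/-- The integrand `Φ(y) α_y[Ψ(y⁻¹x)] ω(y, y⁻¹x)` of the twisted convolution at `x`. -/
noncomputable def convIntegrand (T : TwistedAction G B) (Φ Ψ : G → B) (x y : G) : B :=
  (T.ω y (y⁻¹ * x)).snd (Φ y * T.α y (Ψ (y⁻¹ * x)))

/-- The twisted convolution `Φ * Ψ` of two functions. -/
noncomputable def conv (T : TwistedAction G B) (μ : Measure G) (Φ Ψ : G → B) (x : G) : B :=
  ∫ y, T.convIntegrand Φ Ψ x y ∂μ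

/-- The modular function `Δ` of `G`, normalized by `μ (E x) = Δ(x) μ(E)` for a left Haar measure
`μ`. Mathlib's `modularCharacterFun` is normalized by `μ (E x⁻¹) = modularCharacterFun x • μ E`. -/
noncomputable def modularFunction (G : Type*) [Group G] [TopologicalSpace G]
    [IsTopologicalGroup G] [LocallyCompactSpace G] (x : G) : ℝ :=
  (Measure.modularCharacterFun x⁻¹ : ℝ)

/-- The twisted involution `Φ^*(x) = Δ(x⁻¹) ω(x, x⁻¹)^* α_x[Φ(x⁻¹)^*]` of a function. -/
noncomputable def invol (T : TwistedAction G B) (Φ : G → B) (x : G) : B :=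
  (modularFunction G x⁻¹ : ℂ) • (star (T.ω x x⁻¹)).fst (T.α x (star (Φ x⁻¹)))

/-- The space `L¹_{α,ω}(G, B)` of (classes of) Bochner integrable functions. -/
def L1 (_T : TwistedAction G B) (μ : Measure G) : Type _ := Lp B 1 μ

noncomputable instance (T : TwistedAction G B) (μ : Measure G) : NormedAddCommGroup (T.L1 μ) :=
  inferInstanceAs (NormedAddCommGroup (Lp B 1 μ))

noncomputable instance (T : TwistedAction G B) (μ : Measure G) : NormedSpace ℂ (T.L1 μ) :=
  inferInstanceAs (NormedSpace ℂ (Lp B 1 μ))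

/-- A representative of an element of `L¹_{α,ω}(G, B)`. -/
noncomputable def L1.fn {T : TwistedAction G B} {μ : Measure G} (Φ : T.L1 μ) : G → B :=
  ((show Lp B 1 μ from Φ) : G → B)

open Classical in
/-- The class in `L¹_{α,ω}(G, B)` of a function, with the value `0` if it is not integrable. -/
noncomputable def L1.mk (T : TwistedAction G B) (μ : Measure G) (F : G → B) : T.L1 μ :=
  if h : Integrable F μ then (show T.L1 μ from h.toL1 F) else 0

noncomputable instance (T : TwistedAction G B) (μ : Measure G) : Mul (T.L1 μ) :=
  ⟨fun Φ Ψ => L1.mk T μ (T.conv μ Φ.fn Ψ.fn)⟩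

noncomputable instance (T : TwistedAction G B) (μ : Measure G) : Star (T.L1 μ) :=
  ⟨fun Φ => L1.mk T μ (T.invol Φ.fn)⟩

/-- The convolution integrals of integrable functions converge almost everywhere, and convolution
and involution of integrable functions are integrable, so that the default values of `∫` and of
`L1.mk` do not enter in the operations of `L¹_{α,ω}(G, B)`. -/
structure L1OperationsDefined (T : TwistedAction G B) (μ : Measure G) : Prop where
  integrable_integrand : ∀ Φ Ψ : T.L1 μ, ∀ᵐ x ∂μ, Integrable (T.convIntegrand Φ.fn Ψ.fn x) μ
  integrable_conv : ∀ Φ Ψ : T.L1 μ, Integrable (T.conv μ Φ.fn Ψ.fn) μ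
  integrable_invol : ∀ Φ : T.L1 μ, Integrable (T.invol Φ.fn) μ

end L1

section Inclusion

variable {G A B : Type*} [Group G] [TopologicalSpace G] [IsTopologicalGroup G]
  [LocallyCompactSpace G] [MeasurableSpace G] [BorelSpace G]
  [NonUnitalNormedRing A] [StarRing A] [NormedStarGroup A] [NormedSpace ℂ A]
  [IsScalarTower ℂ A A] [SMulCommClass ℂ A A] [StarModule ℂ A]
  [NonUnitalNormedRing B] [StarRing B] [NormedStarGroup B] [NormedSpace ℂ B]
  [IsScalarTower ℂ B B] [SMulCommClass ℂ B B] [StarModule ℂ B]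

/-- The natural map `L¹_{α,ω}(G, A) → L¹_{α,ω}(G, B)`, `Φ ↦ ι ∘ Φ`. -/
noncomputable def L1incl (S : TwistedAction G A) (T : TwistedAction G B) (μ : Measure G)
    (ι : A →L[ℂ] B) : S.L1 μ →L[ℂ] T.L1 μ :=
  show Lp A 1 μ →L[ℂ] Lp B 1 μ from ι.compLpL 1 μ

end Inclusion

end TwistedAction

/-!
Everything rests on the pointwise operations `a α_p(b) ω(p, q)` and `ω(p, p⁻¹)^* α_p(a^*)`, which
the cocycle relations make associative and involutive; integrated over `G`, their identities become
those of the Banach `*`-algebra `L¹`. Since finitely many integrable functions vanish off an open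
`σ`-compact subgroup, where Haar measure is `σ`-finite, Fubini's theorem is available, but for the
Borel `σ`-algebra of `G × G`, on which `ω` is measurable. As `α` is isometric for both norms, the
differential inequality holds for the pointwise product and can be integrated.

In a dense differential subalgebra, `a^p a^q` depends only on `p + q`, so the differential
inequality with `p` and `q` balanced makes the powers of `a` summable as soon as `‖a‖ < 1` in the
large algebra. An element of `A` that is invertible in `B` is reduced to this case by an
approximate inverse from `A`; a similar series produces an identity of `A` from an identity of `B`.
-/

/-! ### Inverse-closedness of dense differential subalgebras -/

section DifferentialNorm

variable {A B : Type*} [NonUnitalNormedRing A] [NonUnitalNormedRing B] {ι : A →ₙ+* B} {C : ℝ}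

theorem summable_pow_half {ρ : ℝ} (hρ₀ : 0 ≤ ρ) (hρ₁ : ρ < 1) :
    Summable fun n : ℕ => ρ ^ (n / 2) := by
  have heven : (fun k : ℕ => ρ ^ (2 * k / 2)) = fun k => ρ ^ k := by
    funext k
    rw [Nat.mul_div_cancel_left k two_pos]
  have hodd : (fun k : ℕ => ρ ^ ((2 * k + 1) / 2)) = fun k => ρ ^ k := by
    funext k
    rw [show (2 * k + 1) / 2 = k by lia]
  have hgeom := summable_geometric_of_lt_one hρ₀ hρ₁
  refine (HasSum.even_add_odd (m := ∑' k, ρ ^ k) (m' := ∑' k, ρ ^ k) ?_ ?_).summable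
  · rw [heven]
    exact hgeom.hasSum
  · rw [hodd]
    exact hgeom.hasSum

theorem exists_forall_partialSups_le {u c : ℕ → ℝ} (hu : ∀ n, 0 ≤ u n) (hc₀ : ∀ n, 0 ≤ c n)
    (hc : Summable c) (h : ∀ n, u (n + 1) ≤ (1 + c n) * partialSups u n) :
    ∃ M, ∀ n, partialSups u n ≤ M := by
  have hnonneg : ∀ n, 0 ≤ partialSups u n := fun n => (hu n).trans (le_partialSups u n)
  have hstep : ∀ n ≥ 0, partialSups u (n + 1) ≤ (1 + c n) * partialSups u n + 0 := fun n _ => by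
    rw [add_zero, partialSups_add_one]
    exact sup_le (le_mul_of_one_le_left (hnonneg n) (le_add_of_nonneg_right (hc₀ n))) (h n)
  refine ⟨partialSups u 0 * Real.exp (∑' n, c n), fun n => ?_⟩
  calc partialSups u n
      ≤ (partialSups u 0 + ∑ k ∈ Finset.Ico 0 n, 0) * Real.exp (∑ k ∈ Finset.Ico 0 n, c k) :=
        discrete_gronwall (hnonneg 0) hstep (fun n _ => hc₀ n) (fun _ _ => le_rfl) n.zero_le
    _ ≤ partialSups u 0 * Real.exp (∑' n, c n) := by
        rw [Finset.sum_const_zero, add_zero]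
        gcongr
        · exact hnonneg 0
        · exact hc.sum_le_tsum _ fun n _ => hc₀ n

theorem iterate_mul_iterate {f : A → A} {x : A} (hf : ∀ y z, f (y * z) = f y * z)
    (hx : ∀ y, f (x * y) = x * f y) (p q : ℕ) : f^[p] x * f^[q] x = x * f^[p + q] x := by
  induction p with
  | zero => rw [Function.iterate_zero_apply, zero_add]
  | succ p ih =>
    rw [Function.iterate_succ_apply', ← hf, ih, hx, ← Function.iterate_succ_apply' f,
      Nat.add_right_comm]

theorem norm_map_iterate_le {f : A → A} {ρ : ℝ} (hρ₀ : 0 ≤ ρ)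
    (hρ : ∀ y, ‖ι (f y)‖ ≤ ρ * ‖ι y‖) (x : A) (n : ℕ) : ‖ι (f^[n] x)‖ ≤ ρ ^ n * ‖ι x‖ := by
  induction n with
  | zero => simp
  | succ n ih =>
    rw [Function.iterate_succ_apply', pow_succ', mul_assoc]
    exact (hρ _).trans (mul_le_mul_of_nonneg_left ih hρ₀)

/-- A product of two iterates depends only on the sum of their orders. Distributing the order
evenly over the two factors, the differential norm inequality makes the products decay, relative
to the largest iterate so far, like `ρ ^ (n / 2)`. -/
theorem norm_mul_iterate_le (hC : 0 ≤ C)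
    (hdiff : ∀ a b, ‖a * b‖ ≤ C * (‖a‖ * ‖ι b‖ + ‖ι a‖ * ‖b‖)) {f : A → A} {x : A} {ρ : ℝ}
    (hρ₀ : 0 ≤ ρ) (hρ₁ : ρ ≤ 1) (hf : ∀ y z, f (y * z) = f y * z) (hx : ∀ y, f (x * y) = x * f y)
    (hρ : ∀ y, ‖ι (f y)‖ ≤ ρ * ‖ι y‖) (n : ℕ) :
    ‖x * f^[n] x‖ ≤ 2 * C * ‖ι x‖ * ρ ^ (n / 2) * partialSups (fun k => ‖f^[k] x‖) n := by
  set M := partialSups (fun k => ‖f^[k] x‖) n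
  have hM : ∀ k ≤ n, ‖f^[k] x‖ ≤ M := fun k hk => le_partialSups_of_le (fun k => ‖f^[k] x‖) hk
  have hdecay : ∀ k, n / 2 ≤ k → ‖ι (f^[k] x)‖ ≤ ρ ^ (n / 2) * ‖ι x‖ := fun k hk =>
    (norm_map_iterate_le hρ₀ hρ x k).trans
      (mul_le_mul_of_nonneg_right (pow_le_pow_of_le_one hρ₀ hρ₁ hk) (norm_nonneg _))
  calc ‖x * f^[n] x‖ = ‖f^[n / 2] x * f^[n - n / 2] x‖ := by
        rw [iterate_mul_iterate hf hx, Nat.add_sub_cancel' (Nat.div_le_self n 2)]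
    _ ≤ C * (‖f^[n / 2] x‖ * ‖ι (f^[n - n / 2] x)‖ + ‖ι (f^[n / 2] x)‖ * ‖f^[n - n / 2] x‖) :=
        hdiff _ _
    _ ≤ C * (M * (ρ ^ (n / 2) * ‖ι x‖) + ρ ^ (n / 2) * ‖ι x‖ * M) := by
        gcongr
        · exact (norm_nonneg _).trans (hM n le_rfl)
        · exact hM _ (Nat.div_le_self n 2)
        · exact hdecay _ (by lia)
        · exact hdecay _ le_rfl
        · exact hM _ (Nat.sub_le _ _)
    _ = 2 * C * ‖ι x‖ * ρ ^ (n / 2) * M := by ring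

theorem summable_norm_mul_iterate (hC : 0 ≤ C)
    (hdiff : ∀ a b, ‖a * b‖ ≤ C * (‖a‖ * ‖ι b‖ + ‖ι a‖ * ‖b‖)) {f : A → A} {x : A} {K ρ : ℝ}
    (hK₀ : 0 ≤ K) (hρ₀ : 0 ≤ ρ) (hρ₁ : ρ < 1) (hf : ∀ y z, f (y * z) = f y * z)
    (hx : ∀ y, f (x * y) = x * f y) (hK : ∀ y, ‖f y‖ ≤ ‖y‖ + K * ‖x * y‖)
    (hρ : ∀ y, ‖ι (f y)‖ ≤ ρ * ‖ι y‖) : Summable fun n => ‖x * f^[n] x‖ := by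
  have hmul := norm_mul_iterate_le hC hdiff hρ₀ hρ₁.le hf hx hρ
  have hsum : Summable fun n : ℕ => 2 * C * ‖ι x‖ * ρ ^ (n / 2) :=
    (summable_pow_half hρ₀ hρ₁).mul_left _
  obtain ⟨M, hM⟩ : ∃ M, ∀ n, partialSups (fun k => ‖f^[k] x‖) n ≤ M := by
    refine exists_forall_partialSups_le (fun n => norm_nonneg _) (fun n => by positivity)
      (hsum.mul_left K) fun n => ?_
    rw [Function.iterate_succ_apply', add_mul, one_mul, mul_assoc K]
    exact (hK _).trans (add_le_add (le_partialSups (fun k => ‖f^[k] x‖) n)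
      (mul_le_mul_of_nonneg_left (hmul n) hK₀))
  exact .of_nonneg_of_le (fun _ => norm_nonneg _)
    (fun n => (hmul n).trans (mul_le_mul_of_nonneg_left (hM n) (by positivity)))
    (hsum.mul_right M)

theorem isQuasiregular_of_norm_map_lt_one [CompleteSpace A] (hC : 0 ≤ C)
    (hdiff : ∀ a b, ‖a * b‖ ≤ C * (‖a‖ * ‖ι b‖ + ‖ι a‖ * ‖b‖)) {a : A} (ha : ‖ι a‖ < 1) :
    IsQuasiregular a := by
  suffices h : ∀ a : A, ‖ι a‖ < 1 → IsQuasiregular (-a) by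
    simpa using h (-a) (by rwa [map_neg, norm_neg])
  clear ha a
  intro a ha
  set u : ℕ → A := fun n => (a * ·)^[n] a
  have hsucc : ∀ n, u (n + 1) = a * u n := fun n => Function.iterate_succ_apply' _ _ _
  have hcomm : ∀ n, u n * a = a * u n := fun n =>
    iterate_mul_iterate (fun y z => (mul_assoc a y z).symm) (fun _ => rfl) n 0
  have hsum : Summable u := by
    refine (summable_nat_add_iff 1).1 (.of_norm ?_)
    simp only [hsucc]
    refine summable_norm_mul_iterate hC hdiff zero_le_one (norm_nonneg (ι a)) ha
      (fun y z => (mul_assoc a y z).symm) (fun _ => rfl) (fun y => ?_) (fun y => ?_)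
    · rw [one_mul]
      exact le_add_of_nonneg_left (norm_nonneg y)
    · exact (congrArg norm (map_mul ι a y)).trans_le (norm_mul_le _ _)
  have hleft : a * ∑' n, u n = ∑' n, u n - a := by
    rw [eq_sub_iff_add_eq', ← hsum.tsum_mul_left, hsum.tsum_eq_zero_add]
    simp only [hsucc]
    rfl
  have hright : (∑' n, u n) * a = ∑' n, u n - a := by
    rw [← hleft, ← hsum.tsum_mul_left, ← hsum.tsum_mul_right]
    simp only [hcomm]
  refine isQuasiregular_iff.2 ⟨∑' n, u n, ?_, ?_⟩
  · rw [neg_mul, hleft]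
    abel
  · rw [mul_neg, hright]
    abel

/-- An approximate quasi-inverse of `ι a` taken in the range of `ι` corrects `a`, from either side,
to an element of small norm in `B`. -/
theorem isQuasiregular_of_isQuasiregular_map [CompleteSpace A] (hC : 0 ≤ C)
    (hdiff : ∀ a b, ‖a * b‖ ≤ C * (‖a‖ * ‖ι b‖ + ‖ι a‖ * ‖b‖)) (hι : DenseRange ι) {a : A}
    (ha : IsQuasiregular (ι a)) : IsQuasiregular a := by
  obtain ⟨y, hy₁, hy₂⟩ := isQuasiregular_iff.1 ha
  have hsmall : ∀ g : B → B, Continuous g → g y = 0 → ∀ᶠ z in nhds y, ‖g z‖ < 1 :=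
    fun g hg h0 => (hg.norm.tendsto' y 0 (by rw [h0, norm_zero])).eventually_lt_const one_pos
  obtain ⟨_, ⟨b, rfl⟩, hb₁, hb₂⟩ := ((mem_closure_iff_frequently.1 (hι y)).and_eventually
    ((hsmall (fun z => z + ι a + ι a * z) (by fun_prop) hy₁).and
      (hsmall (fun z => ι a + z + z * ι a) (by fun_prop) hy₂))).exists
  have hab : IsUnit (PreQuasiregular.equiv a * PreQuasiregular.equiv b) :=
    isQuasiregular_iff'.1 (isQuasiregular_of_norm_map_lt_one hC hdiff (a := b + a + a * b)
      (by simpa only [map_add, map_mul] using hb₁))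
  have hba : IsUnit (PreQuasiregular.equiv b * PreQuasiregular.equiv a) :=
    isQuasiregular_iff'.1 (isQuasiregular_of_norm_map_lt_one hC hdiff (a := a + b + b * a)
      (by simpa only [map_add, map_mul] using hb₂))
  obtain ⟨r, hr⟩ := hab.exists_right_inv
  obtain ⟨l, hl⟩ := hba.exists_left_inv
  exact isQuasiregular_iff'.2 (isUnit_iff_exists_and_exists.2
    ⟨⟨_, (mul_assoc _ _ _).symm.trans hr⟩, ⟨_, (mul_assoc _ _ _).trans hl⟩⟩)

/-- With `b ∈ A` such that `‖e - ι (b * b)‖ < 1`, the series `s = ∑ b (1 - b²)ⁿ b` converges in `A`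
and satisfies `b² s = b²`. -/
theorem exists_map_isIdentity [CompleteSpace A] (hC : 0 ≤ C)
    (hdiff : ∀ a b, ‖a * b‖ ≤ C * (‖a‖ * ‖ι b‖ + ‖ι a‖ * ‖b‖)) (hι : DenseRange ι) {e : B}
    (he : IsIdentity e) : ∃ s, ι s = e := by
  obtain ⟨b, hb⟩ : ∃ b, ‖e - ι (b * b)‖ < 1 := by
    have hcont : Filter.Tendsto (fun z => ‖e - z * z‖) (nhds e) (nhds 0) :=
      Continuous.tendsto' (by fun_prop) _ _ (by rw [(he e).1, sub_self, norm_zero])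
    obtain ⟨_, ⟨b, rfl⟩, hb⟩ := ((mem_closure_iff_frequently.1 (hι e)).and_eventually
      (hcont.eventually_lt_const one_pos)).exists
    exact ⟨b, by rwa [map_mul]⟩
  set f : A → A := fun y => y - b * b * y
  have hf : ∀ y z, f (y * z) = f y * z := fun y z => by simp only [f, sub_mul, mul_assoc]
  have hfb : ∀ y, f (b * y) = b * f y := fun y => by simp only [f, mul_sub, mul_assoc]
  have hιf : ∀ y, ι (f y) = (e - ι (b * b)) * ι y := fun y => by
    rw [sub_mul, (he _).1, map_sub, map_mul ι (b * b)]
  have hsum : Summable fun n => b * f^[n] b := by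
    refine .of_norm (summable_norm_mul_iterate hC hdiff (norm_nonneg b) (norm_nonneg _) hb hf hfb
      (fun y => ?_) (fun y => (congrArg norm (hιf y)).trans_le (norm_mul_le _ _)))
    exact (norm_sub_le _ _).trans
      (add_le_add_right ((congrArg norm (mul_assoc b b y)).trans_le (norm_mul_le _ _)) _)
  have hs : b * b * ∑' n, b * f^[n] b = b * b := by
    have hstep : ∀ n, b * b * (b * f^[n] b) = b * f^[n] b - b * f^[n + 1] b := fun n => by
      rw [Function.iterate_succ_apply', ← hfb, sub_sub_cancel]
    rw [← hsum.tsum_mul_left]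
    simp only [hstep]
    rw [hsum.tsum_sub ((summable_nat_add_iff 1).2 hsum), hsum.tsum_eq_zero_add,
      add_sub_cancel_right, Function.iterate_zero_apply]
  refine ⟨∑' n, b * f^[n] b, ?_⟩
  set s := ∑' n, b * f^[n] b
  have hfix : e - ι s = (e - ι (b * b)) * (e - ι s) := by
    rw [mul_sub, (he _).2, ← hιf, map_sub, hs, sub_sub_sub_cancel_right]
  have hnorm : ‖e - ι s‖ ≤ ‖e - ι (b * b)‖ * ‖e - ι s‖ :=
    (congrArg norm hfix).trans_le (norm_mul_le _ _)
  have hzero : ‖e - ι s‖ ≤ 0 := by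
    by_contra! hpos
    exact (mul_lt_of_lt_one_left hpos hb).not_ge hnorm
  exact (sub_eq_zero.1 (norm_le_zero_iff.1 hzero)).symm

end DifferentialNorm

section AlgSpectrum

variable {A B : Type*} [NonUnitalNormedRing A] [NormedSpace ℂ A] [NonUnitalNormedRing B]
  [NormedSpace ℂ B]

theorem IsIdentity.eq {M : Type*} [Mul M] {e e' : M} (he : IsIdentity e) (he' : IsIdentity e') :
    e = e' :=
  (he' e).2.symm.trans (he e').1

theorem IsIdentity.add_mul_add_eq_iff {R : Type*} [NonUnitalNonAssocRing R] {e : R}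
    (he : IsIdentity e) (x y : R) : (x + e) * (y + e) = e ↔ y + x + x * y = 0 := by
  rw [add_mul, mul_add, (he _).1, (he _).2, ← add_assoc, add_eq_right, add_assoc, add_comm,
    add_comm x y]

theorem IsIdentity.algSpectrum_eq {e : A} (he : IsIdentity e) (a : A) :
    algSpectrum a = {z : ℂ | ¬ IsQuasiregular (z • e - a - e)} := by
  have hshift : ∀ z : ℂ, (∃ b, (z • e - a) * b = e ∧ b * (z • e - a) = e) ↔
      IsQuasiregular (z • e - a - e) := fun z => by
    obtain ⟨x, hx⟩ : ∃ x, z • e - a = x + e := ⟨_, (sub_add_cancel _ e).symm⟩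
    rw [hx, add_sub_cancel_right, isQuasiregular_iff, ← (Equiv.addRight e).exists_congr_right]
    simp only [Equiv.coe_addRight, he.add_mul_add_eq_iff]
  ext z
  simp only [algSpectrum, Set.mem_ofPred_eq, ← hshift]
  exact ⟨fun h => h.1 e he, fun h => ⟨fun e' he' => he.eq he' ▸ h, fun h' => (h' ⟨e, he⟩).elim⟩⟩

theorem algSpectrum_eq_quasispectrum [IsScalarTower ℂ A A] [SMulCommClass ℂ A A]
    (h : ¬ ∃ e : A, IsIdentity e) (a : A) : algSpectrum a = quasispectrum ℂ a := by
  rw [Unitization.quasispectrum_eq_spectrum_inr]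
  ext z
  simp only [algSpectrum, Set.mem_ofPred_eq, spectrum.mem_iff, Unitization.algebraMap_eq_inl,
    isUnit_iff_exists]
  exact ⟨fun hz => hz.2 h, fun hz => ⟨fun e he => (h ⟨e, he⟩).elim, fun _ => hz⟩⟩

theorem isInverseClosed_of_isQuasiregular_iff [IsScalarTower ℂ A A] [SMulCommClass ℂ A A]
    [IsScalarTower ℂ B B] [SMulCommClass ℂ B B] {ι : A →L[ℂ] B}
    (hid : (∃ e : A, IsIdentity e ∧ IsIdentity (ι e)) ∨
      ((¬ ∃ e : A, IsIdentity e) ∧ ¬ ∃ e : B, IsIdentity e))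
    (hι : ∀ a, IsQuasiregular (ι a) ↔ IsQuasiregular a) : IsInverseClosed ι := by
  intro a
  obtain ⟨e, heA, heB⟩ | ⟨hA, hB⟩ := hid
  · rw [heA.algSpectrum_eq, heB.algSpectrum_eq]
    simp only [← hι, map_sub, map_smul]
  · rw [algSpectrum_eq_quasispectrum hA, algSpectrum_eq_quasispectrum hB]
    simp only [quasispectrum, ← hι, map_neg, Units.smul_def, map_smul]

end AlgSpectrum

/-- The non-unital normed ring structure underlying a Banach `*`-algebra. -/
abbrev IsBanachStarAlgebra.toNonUnitalNormedRing {A : Type*} [i : NormedAddCommGroup A]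
    [NormedSpace ℂ A] [Mul A] [Star A] (h : IsBanachStarAlgebra A) : NonUnitalNormedRing A where
  toNorm := i.toNorm
  toMetricSpace := i.toMetricSpace
  toAddCommGroup := i.toAddCommGroup
  dist_eq := i.dist_eq
  mul := (· * ·)
  left_distrib := h.mul_add
  right_distrib := h.add_mul
  zero_mul a := by simpa using h.smul_mul 0 0 a
  mul_zero a := by simpa using h.mul_smul 0 a 0
  mul_assoc := h.mul_assoc
  norm_mul_le := h.norm_mul_le

theorem IsDifferentialSubalgebra.isInverseClosed {A B : Type*}
    [NormedAddCommGroup A] [NormedSpace ℂ A] [Mul A] [Star A]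
    [NormedAddCommGroup B] [NormedSpace ℂ B] [Mul B] [Star B] {ι : A →L[ℂ] B}
    (h : IsDifferentialSubalgebra ι) (hdense : DenseRange ι) : IsInverseClosed ι := by
  obtain ⟨C, hC, hdiff⟩ := h.norm_mul_le
  let := h.banach_left.toNonUnitalNormedRing
  let := h.banach_right.toNonUnitalNormedRing
  have := h.banach_left.complete
  have : IsScalarTower ℂ A A := ⟨h.banach_left.smul_mul⟩
  have : SMulCommClass ℂ A A := ⟨fun z a b => (h.banach_left.mul_smul z a b).symm⟩
  have : IsScalarTower ℂ B B := ⟨h.banach_right.smul_mul⟩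
  have : SMulCommClass ℂ B B := ⟨fun z a b => (h.banach_right.mul_smul z a b).symm⟩
  let φ : A →ₙ+* B := ⟨⟨ι, h.map_mul⟩, map_zero ι, map_add ι⟩
  refine isInverseClosed_of_isQuasiregular_iff ?_ fun a =>
    ⟨isQuasiregular_of_isQuasiregular_map (ι := φ) hC.le hdiff hdense, fun ha => ha.map φ⟩
  by_cases hA : ∃ e : A, IsIdentity e
  · obtain ⟨e, he⟩ := hA
    exact .inl ⟨e, he, h.map_identity e he⟩
  · refine .inr ⟨hA, fun ⟨e, he⟩ => hA ?_⟩
    obtain ⟨s, rfl⟩ := exists_map_isIdentity (ι := φ) hC.le hdiff hdense he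
    refine ⟨s, fun a => ⟨h.injective ?_, h.injective ?_⟩⟩
    · exact (h.map_mul s a).trans (he (ι a)).1
    · exact (h.map_mul a s).trans (he (ι a)).2

/-! ### Fubini's theorem for the Borel `σ`-algebra of a product -/

section BorelProd

open Set ProbabilityTheory
open scoped ENNReal Topology

/-- The product of two topological spaces, with the Borel `σ`-algebra of the product topology
(in general larger than the product of the Borel `σ`-algebras). -/
def BorelProd (X Y : Type*) := X × Y

theorem measure_eq_zero_of_forall_nhdsWithin {X : Type*} [TopologicalSpace X] [MeasurableSpace X]
    {m : Measure X} [m.InnerRegular] {A : Set X} (hA : MeasurableSet A)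
    (h : ∀ x ∈ A, ∃ u ∈ 𝓝[A] x, m u = 0) : m A = 0 := by
  by_contra hne
  obtain ⟨K, hKA, hK, hK₀⟩ := hA.exists_lt_isCompact (pos_iff_ne_zero.2 hne)
  refine hK₀.ne' (hK.measure_zero_of_nhdsWithin fun x hx => ?_)
  obtain ⟨u, hu, hu₀⟩ := h x (hKA hx)
  exact ⟨u, nhdsWithin_mono x hKA hu, hu₀⟩

theorem exists_sum_eq_of_sigmaFinite {X : Type*} [TopologicalSpace X] [MeasurableSpace X]
    [OpensMeasurableSpace X] (m : Measure X) [SigmaFinite m] [m.InnerRegularCompactLTTop] :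
    ∃ p : ℕ → Measure X, (∀ i, IsFiniteMeasure (p i)) ∧ (∀ i, (p i).InnerRegular) ∧
      Measure.sum p = m := by
  have hfin : ∀ i, IsFiniteMeasure (m.restrict (disjointed (spanningSets m) i)) := fun i =>
    ⟨by
      rw [Measure.restrict_apply_univ]
      exact (measure_mono (disjointed_subset _ _)).trans_lt (measure_spanningSets_lt_top m i)⟩
  refine ⟨fun i => m.restrict (disjointed (spanningSets m) i), hfin, fun i => ?_,
    sum_restrict_disjointed_spanningSets m m⟩
  have := hfin i
  infer_instance

namespace BorelProd

variable {X Y : Type*} [TopologicalSpace X] [TopologicalSpace Y]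

instance : TopologicalSpace (BorelProd X Y) := inferInstanceAs (TopologicalSpace (X × Y))

instance : MeasurableSpace (BorelProd X Y) := borel _

instance : BorelSpace (BorelProd X Y) := ⟨rfl⟩

/-- The pair `(x, y)`. -/
def mk (x : X) (y : Y) : BorelProd X Y := (x, y)

/-- The first coordinate. -/
def fst (z : BorelProd X Y) : X := Prod.fst z

/-- The second coordinate. -/
def snd (z : BorelProd X Y) : Y := Prod.snd z

/-- The exchange of the two coordinates. -/
def swap (z : BorelProd X Y) : BorelProd Y X := mk z.snd z.fst

theorem continuous_fst : Continuous (fst : BorelProd X Y → X) := _root_.continuous_fst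

theorem continuous_snd : Continuous (snd : BorelProd X Y → Y) := _root_.continuous_snd

theorem continuous_mk {Z : Type*} [TopologicalSpace Z] {f : Z → X} {g : Z → Y}
    (hf : Continuous f) (hg : Continuous g) : Continuous fun z => mk (f z) (g z) :=
  hf.prodMk hg

theorem continuous_swap : Continuous (swap : BorelProd X Y → BorelProd Y X) :=
  continuous_mk continuous_snd continuous_fst

theorem measurable_mk_left [MeasurableSpace Y] [BorelSpace Y] (x : X) :
    Measurable fun y : Y => mk x y :=
  (continuous_mk continuous_const continuous_id).measurable

theorem exists_isOpen_of_lt_measure [MeasurableSpace Y] [OpensMeasurableSpace Y] {n : Measure Y}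
    [n.InnerRegular] {E : Set (BorelProd X Y)} (hE : IsOpen E) {x : X} {q : ℝ≥0∞}
    (hq : q < n (mk x ⁻¹' E)) :
    ∃ (U : Set X) (V : Set Y), IsOpen U ∧ IsOpen V ∧ x ∈ U ∧ q < n V ∧
      ∀ a ∈ U, ∀ b ∈ V, mk a b ∈ E := by
  have hEx : IsOpen (mk x ⁻¹' E) := hE.preimage (continuous_mk continuous_const continuous_id)
  obtain ⟨K, hKE, hK, hqK⟩ := hEx.measurableSet.exists_lt_isCompact hq
  have hsub : {x} ×ˢ K ⊆ (E : Set (X × Y)) := by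
    rintro ⟨a, b⟩ ⟨rfl, hb⟩
    exact hKE hb
  obtain ⟨U, V, hU, hV, hxU, hKV, hUV⟩ :=
    generalized_tube_lemma (n := (E : Set (X × Y))) isCompact_singleton hK hE hsub
  exact ⟨U, V, hU, hV, hxU rfl, hqK.trans_le (measure_mono hKV), fun a ha b hb => hUV ⟨ha, hb⟩⟩

theorem exists_maximal_isOpen_measurableSet [MeasurableSpace X]
    [MeasurableSpace Y] (ρ : Measure (X × Y)) [IsFiniteMeasure ρ] (E : Set (X × Y)) :
    ∃ F ⊆ E, MeasurableSet F ∧ ∀ R ⊆ E, MeasurableSet R → IsOpen R → ρ (R \ F) = 0 := by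
  set S : Set ℝ≥0∞ := ρ '' {F | F ⊆ E ∧ MeasurableSet F ∧ IsOpen F}
  have hne : S.Nonempty := ⟨ρ ∅, ∅, ⟨empty_subset _, .empty, isOpen_empty⟩, rfl⟩
  obtain ⟨u, -, hu, huS⟩ := exists_seq_tendsto_sSup hne (OrderTop.bddAbove S)
  choose F hF hFu using huS
  have hm : MeasurableSet (⋃ i, F i) := .iUnion fun i => (hF i).2.1
  have hsub : ⋃ i, F i ⊆ E := iUnion_subset fun i => (hF i).1
  refine ⟨⋃ i, F i, hsub, hm, fun R hRE hRm hR => ?_⟩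
  have hle : sSup S ≤ ρ (⋃ i, F i) := le_of_tendsto' hu fun i => by
    rw [← hFu]
    exact measure_mono (subset_iUnion F i)
  have hge : ρ (R ∪ ⋃ i, F i) ≤ sSup S := le_sSup ⟨_, ⟨union_subset hRE hsub,
    hRm.union hm, hR.union (isOpen_iUnion fun i => (hF i).2.2)⟩, rfl⟩
  rw [← union_sdiff_right, measure_sdiff subset_union_right hm.nullMeasurableSet
    (measure_ne_top _ _)]
  exact tsub_eq_zero_of_le (hge.trans hle)

variable [MeasurableSpace X] [BorelSpace X] [MeasurableSpace Y] [BorelSpace Y]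

theorem measurable_map_mk_of_isFiniteMeasure {n : Measure Y} [IsFiniteMeasure n]
    [n.InnerRegular] : Measurable fun x : X => n.map (mk x) := by
  refine .measure_of_isPiSystem (BorelSpace.measurable_eq.trans rfl) isPiSystem_isOpen
    (fun E (hE : IsOpen E) => measurable_of_Ioi fun q => IsOpen.measurableSet ?_) ?_
  · simp_rw [Measure.map_apply (measurable_mk_left _) hE.measurableSet]
    refine isOpen_iff_forall_mem_open.2 fun x hx => ?_
    obtain ⟨U, V, hU, -, hxU, hq, hUV⟩ := exists_isOpen_of_lt_measure hE hx
    exact ⟨U, fun a ha => hq.trans_le (measure_mono fun b hb => hUV a ha b hb), hU, hxU⟩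
  · simp only [Measure.map_apply (measurable_mk_left _) .univ, preimage_univ, measurable_const]

theorem measurable_map_mk {n : Measure Y} [SigmaFinite n] [n.InnerRegularCompactLTTop] :
    Measurable fun x : X => n.map (mk x) := by
  obtain ⟨p, _, _, rfl⟩ := exists_sum_eq_of_sigmaFinite n
  simp_rw [Measure.map_sum (measurable_mk_left _).aemeasurable]
  refine Measure.measurable_of_measurable_coe _ fun E hE => ?_
  simp_rw [Measure.sum_apply _ hE]
  exact .tsum fun i => (Measure.measurable_coe hE).comp measurable_map_mk_of_isFiniteMeasure

variable (X) in
/-- The kernel that sends `x` to the copy of the measure `n` on the fiber of `BorelProd X Y`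
over `x`. -/
noncomputable def fiberKernel (n : Measure Y) [SigmaFinite n] [n.InnerRegularCompactLTTop] :
    Kernel X (BorelProd X Y) where
  toFun x := n.map (mk x)
  measurable' := measurable_map_mk

/-- The extension of the product of the measures `m` and `n` to the Borel `σ`-algebra of the
product space. -/
noncomputable def prod (m : Measure X) (n : Measure Y) [SigmaFinite n]
    [n.InnerRegularCompactLTTop] : Measure (BorelProd X Y) :=
  m.bind (fiberKernel X n)

theorem lintegral_fiberKernel {n : Measure Y} [SigmaFinite n] [n.InnerRegularCompactLTTop]
    {f : BorelProd X Y → ℝ≥0∞} (hf : Measurable f) (x : X) :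
    ∫⁻ z, f z ∂fiberKernel X n x = ∫⁻ y, f (mk x y) ∂n :=
  lintegral_map hf (measurable_mk_left x)

theorem lintegral_prod {m : Measure X} {n : Measure Y} [SigmaFinite n]
    [n.InnerRegularCompactLTTop] {f : BorelProd X Y → ℝ≥0∞} (hf : Measurable f) :
    ∫⁻ z, f z ∂prod m n = ∫⁻ x, ∫⁻ y, f (mk x y) ∂n ∂m :=
  (Measure.lintegral_bind (Kernel.aemeasurable _) hf.aemeasurable).trans
    (lintegral_congr (lintegral_fiberKernel hf))

theorem prod_apply {m : Measure X} {n : Measure Y} [SigmaFinite n] [n.InnerRegularCompactLTTop]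
    {E : Set (BorelProd X Y)} (hE : MeasurableSet E) :
    prod m n E = ∫⁻ x, n (mk x ⁻¹' E) ∂m :=
  (Measure.bind_apply hE (Kernel.aemeasurable _)).trans
    (lintegral_congr fun x => Measure.map_apply (measurable_mk_left x) hE)

section FiniteMeasure

variable {m : Measure X} {n : Measure Y} [IsFiniteMeasure n] [m.InnerRegular] [n.InnerRegular]

theorem ae_measure_section_le {E : Set (BorelProd X Y)} (hE : IsOpen E) {F : Set (X × Y)}
    (hF : MeasurableSet F) (hmax : ∀ R : Set (X × Y), R ⊆ (show Set (X × Y) from E) →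
      MeasurableSet R → IsOpen R → m.prod n (R \ F) = 0) :
    ∀ᵐ x ∂m, n (mk x ⁻¹' E) ≤ n (Prod.mk x ⁻¹' F) := by
  have hEm : Measurable fun x => n (mk x ⁻¹' E) := by
    simp_rw [← Measure.map_apply (measurable_mk_left _) hE.measurableSet]
    exact (Measure.measurable_coe hE.measurableSet).comp measurable_map_mk
  have hFm : Measurable fun x => n (Prod.mk x ⁻¹' F) := measurable_measure_prodMk_left hF
  have hnull : ∀ q : ℚ, ∀ᵐ x ∂m, ¬(n (Prod.mk x ⁻¹' F) ≤ .ofReal q ∧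
      .ofReal q < n (mk x ⁻¹' E)) := fun q => by
    simp only [ae_iff, not_not]
    refine measure_eq_zero_of_forall_nhdsWithin
      ((measurableSet_le hFm measurable_const).inter (measurableSet_lt measurable_const hEm))
      fun x hx => ?_
    obtain ⟨U, V, hU, hV, hxU, hq, hUV⟩ := exists_isOpen_of_lt_measure hE hx.2
    have hUVm := hU.measurableSet.prod hV.measurableSet
    have hUVF : ∀ᵐ a ∂m, n (Prod.mk a ⁻¹' (U ×ˢ V \ F)) = 0 :=
      (Measure.measure_prod_null (hUVm.diff hF)).1
        (hmax _ (fun p hp => hUV _ hp.1 _ hp.2) hUVm (hU.prod hV))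
    refine ⟨_, inter_mem_nhdsWithin _ (hU.mem_nhds hxU), measure_mono_null ?_ (ae_iff.1 hUVF)⟩
    rintro a ⟨⟨haF, -⟩, haU⟩ (ha : n _ = 0)
    have hV : V ⊆ Prod.mk a ⁻¹' (U ×ˢ V \ F) ∪ Prod.mk a ⁻¹' F := fun b hb =>
      (em ((a, b) ∈ F)).symm.imp_left fun h => ⟨⟨haU, hb⟩, h⟩
    have hVF : n V ≤ n (Prod.mk a ⁻¹' F) := by
      simpa only [ha, zero_add] using
        (measure_mono (μ := n) hV).trans (measure_union_le _ _)
    exact (hVF.trans haF).not_gt hq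
  filter_upwards [ae_all_iff.2 hnull] with x hx
  by_contra! hlt
  obtain ⟨q, -, hFq, hqE⟩ := ENNReal.lt_iff_exists_rat_btwn.1 hlt
  exact hx q ⟨hFq.le, hqE⟩

variable [IsFiniteMeasure m]

/-- The usual Fubini theorem applies to a largest product-measurable open subset of `E`, whose
sections exhaust almost all sections of `E` in one of the two directions. -/
theorem prod_le_prod_preimage_swap {E : Set (BorelProd X Y)} (hE : IsOpen E) :
    prod m n E ≤ prod n m (swap ⁻¹' E) := by
  obtain ⟨F, hFE, hF, hmax⟩ := exists_maximal_isOpen_measurableSet (m.prod n) E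
  calc prod m n E = ∫⁻ x, n (mk x ⁻¹' E) ∂m := prod_apply hE.measurableSet
    _ ≤ ∫⁻ x, n (Prod.mk x ⁻¹' F) ∂m := lintegral_mono_ae (ae_measure_section_le hE hF hmax)
    _ = ∫⁻ y, m ((·, y) ⁻¹' F) ∂n := by
        rw [← Measure.prod_apply hF, Measure.prod_apply_symm hF]
    _ ≤ ∫⁻ y, m (mk y ⁻¹' (swap ⁻¹' E)) ∂n :=
        lintegral_mono fun y => measure_mono fun x hx => hFE hx
    _ = prod n m (swap ⁻¹' E) := (prod_apply (hE.preimage continuous_swap).measurableSet).symm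

theorem map_swap_prod_of_isFiniteMeasure : (prod n m).map swap = prod m n := by
  have hfin : IsFiniteMeasure (prod m n) := ⟨by
    simp [prod_apply, ENNReal.mul_lt_top]⟩
  refine (ext_of_generate_finite {E | IsOpen E} (BorelSpace.measurable_eq.trans rfl)
    isPiSystem_isOpen (fun E (hE : IsOpen E) => ?_) ?_).symm
  · rw [Measure.map_apply continuous_swap.measurable hE.measurableSet]
    exact (prod_le_prod_preimage_swap hE).antisymm
      (prod_le_prod_preimage_swap (hE.preimage continuous_swap))
  · simp [Measure.map_apply continuous_swap.measurable, prod_apply, mul_comm]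

end FiniteMeasure

variable {m : Measure X} {n : Measure Y} [SigmaFinite m] [SigmaFinite n]
  [m.InnerRegularCompactLTTop] [n.InnerRegularCompactLTTop]

theorem prod_sum_apply {p : ℕ → Measure X} {q : ℕ → Measure Y} [∀ j, SigmaFinite (q j)]
    [∀ j, (q j).InnerRegularCompactLTTop] [SigmaFinite (Measure.sum q)]
    [(Measure.sum q).InnerRegularCompactLTTop] {E : Set (BorelProd X Y)} (hE : MeasurableSet E) :
    prod (Measure.sum p) (Measure.sum q) E = ∑' i, ∑' j, prod (p i) (q j) E := by
  have hm : ∀ j, Measurable fun x => q j (mk x ⁻¹' E) := fun j => by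
    simp_rw [← Measure.map_apply (measurable_mk_left _) hE]
    exact (Measure.measurable_coe hE).comp measurable_map_mk
  simp_rw [prod_apply hE, lintegral_sum_measure, Measure.sum_apply _ (measurable_mk_left _ hE),
    lintegral_tsum fun j => (hm j).aemeasurable]

theorem map_swap_prod : (prod n m).map swap = prod m n := by
  obtain ⟨p, hp, hp', rfl⟩ := exists_sum_eq_of_sigmaFinite m
  obtain ⟨q, hq, hq', rfl⟩ := exists_sum_eq_of_sigmaFinite n
  ext E hE
  have hE' : MeasurableSet (swap ⁻¹' E : Set (BorelProd Y X)) := continuous_swap.measurable hE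
  rw [Measure.map_apply continuous_swap.measurable hE, prod_sum_apply hE, prod_sum_apply hE',
    ENNReal.tsum_comm]
  refine tsum_congr fun i => tsum_congr fun j => ?_
  rw [← map_swap_prod_of_isFiniteMeasure (m := p i),
    Measure.map_apply continuous_swap.measurable hE]

theorem lintegral_lintegral_swap {f : X → Y → ℝ≥0∞}
    (hf : Measurable fun z : BorelProd X Y => f z.fst z.snd) :
    ∫⁻ x, ∫⁻ y, f x y ∂n ∂m = ∫⁻ y, ∫⁻ x, f x y ∂m ∂n := calc
  _ = ∫⁻ z, f z.fst z.snd ∂prod m n := (lintegral_prod hf).symm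
  _ = ∫⁻ z, f (swap z).fst (swap z).snd ∂prod n m := by
    rw [← map_swap_prod, lintegral_map hf continuous_swap.measurable]
  _ = ∫⁻ y, ∫⁻ x, f x y ∂m ∂n := lintegral_prod (hf.comp continuous_swap.measurable)

theorem measurable_lintegral_right {n : Measure Y} [SigmaFinite n] [n.InnerRegularCompactLTTop]
    {f : X → Y → ℝ≥0∞} (hf : Measurable fun z : BorelProd X Y => f z.fst z.snd) :
    Measurable fun x => ∫⁻ y, f x y ∂n := by
  have hκ := hf.lintegral_kernel (κ := fiberKernel X n)
  simp_rw [lintegral_fiberKernel hf] at hκ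
  exact hκ

variable {F : Type*} [NormedAddCommGroup F] [NormedSpace ℝ F]

theorem integral_fiberKernel {n : Measure Y} [SigmaFinite n] [n.InnerRegularCompactLTTop]
    {f : BorelProd X Y → F} (hf : StronglyMeasurable f) (x : X) :
    ∫ z, f z ∂fiberKernel X n x = ∫ y, f (mk x y) ∂n :=
  integral_map (measurable_mk_left x).aemeasurable hf.aestronglyMeasurable

theorem stronglyMeasurable_integral_right {n : Measure Y} [SigmaFinite n]
    [n.InnerRegularCompactLTTop] {f : X → Y → F}
    (hf : StronglyMeasurable fun z : BorelProd X Y => f z.fst z.snd) :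
    StronglyMeasurable fun x => ∫ y, f x y ∂n := by
  have hκ := hf.integral_kernel (κ := fiberKernel X n)
  simp_rw [integral_fiberKernel hf] at hκ
  exact hκ

theorem integral_prod {m : Measure X} {n : Measure Y} [SigmaFinite n]
    [n.InnerRegularCompactLTTop] {f : BorelProd X Y → F} (hf : StronglyMeasurable f)
    (hint : Integrable f (prod m n)) : ∫ z, f z ∂prod m n = ∫ x, ∫ y, f (mk x y) ∂n ∂m := by
  have hcomp := hint
  rw [prod, Measure.comp_eq_comp_const_apply] at hcomp
  rw [prod, Measure.comp_eq_comp_const_apply, Kernel.integral_comp hcomp, Kernel.const_apply]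
  exact integral_congr_ae (ae_of_all _ (integral_fiberKernel hf))

theorem integral_integral_swap {f : X → Y → F}
    (hf : StronglyMeasurable fun z : BorelProd X Y => f z.fst z.snd)
    (hfin : ∫⁻ x, ∫⁻ y, ‖f x y‖ₑ ∂n ∂m ≠ ∞) :
    ∫ x, ∫ y, f x y ∂n ∂m = ∫ y, ∫ x, f x y ∂m ∂n := by
  have hswap : Measurable (swap : BorelProd Y X → BorelProd X Y) := continuous_swap.measurable
  have hint : Integrable (fun z : BorelProd X Y => f z.fst z.snd) (prod m n) := by
    refine ⟨hf.aestronglyMeasurable, ?_⟩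
    rw [hasFiniteIntegral_iff_enorm, lintegral_prod hf.enorm]
    exact hfin.lt_top
  have hint' : Integrable (fun z : BorelProd Y X => f (swap z).fst (swap z).snd) (prod n m) := by
    rw [← map_swap_prod] at hint
    exact hint.comp_measurable hswap
  calc ∫ x, ∫ y, f x y ∂n ∂m = ∫ z, f z.fst z.snd ∂prod m n := (integral_prod hf hint).symm
    _ = ∫ z, f (swap z).fst (swap z).snd ∂prod n m := by
      rw [← map_swap_prod, integral_map hswap.aemeasurable hf.aestronglyMeasurable]
    _ = ∫ y, ∫ x, f x y ∂m ∂n := integral_prod (hf.comp_measurable hswap) hint'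

end BorelProd

end BorelProd

/-! ### Haar measure and `σ`-compact open subgroups -/

section SigmaCompact

open Set
open scoped Pointwise

theorem isSigmaCompact_prod {X Y : Type*} [TopologicalSpace X] [TopologicalSpace Y] {S : Set X}
    {R : Set Y} (hS : IsSigmaCompact S) (hR : IsSigmaCompact R) : IsSigmaCompact (S ×ˢ R) := by
  obtain ⟨K, hK, rfl⟩ := hS
  obtain ⟨L, hL, rfl⟩ := hR
  rw [prod_iUnion]
  simp_rw [iUnion_prod_const]
  exact isSigmaCompact_iUnion _ fun j => isSigmaCompact_iUnion _ fun i =>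
    ((hK i).prod (hL j)).isSigmaCompact

theorem isSigmaCompact_union {X : Type*} [TopologicalSpace X] {S R : Set X}
    (hS : IsSigmaCompact S) (hR : IsSigmaCompact R) : IsSigmaCompact (S ∪ R) := by
  rw [union_eq_iUnion]
  exact isSigmaCompact_iUnion _ (Bool.forall_bool.2 ⟨hR, hS⟩)

variable {G : Type*} [Group G] [TopologicalSpace G] [IsTopologicalGroup G]

theorem isSigmaCompact_pow {S : Set G} (hS : IsSigmaCompact S) (n : ℕ) :
    IsSigmaCompact (S ^ n) := by
  induction n with
  | zero => exact isCompact_singleton.isSigmaCompact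
  | succ n ih =>
    rw [pow_succ, ← image_mul_prod]
    exact (isSigmaCompact_prod ih hS).image continuous_mul

theorem coe_submonoidClosure_eq_iUnion_pow {M : Type*} [Monoid M] (S : Set M) :
    (Submonoid.closure S : Set M) = ⋃ n, S ^ n := by
  refine subset_antisymm (fun x hx => ?_)
    (iUnion_subset fun n => Submonoid.pow_subset Submonoid.subset_closure)
  induction hx using Submonoid.closure_induction with
  | mem x hx => exact mem_iUnion.2 ⟨1, (pow_one S).symm ▸ hx⟩
  | one => exact mem_iUnion.2 ⟨0, one_mem_one⟩
  | mul x y _ _ hx hy =>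
    obtain ⟨i, hi⟩ := mem_iUnion.1 hx
    obtain ⟨j, hj⟩ := mem_iUnion.1 hy
    exact mem_iUnion.2 ⟨i + j, pow_add S i j ▸ mul_mem_mul hi hj⟩

theorem isSigmaCompact_subgroupClosure {S : Set G} (hS : IsSigmaCompact S) :
    IsSigmaCompact (Subgroup.closure S : Set G) := by
  rw [← Subgroup.coe_toSubmonoid, Subgroup.closure_toSubmonoid,
    coe_submonoidClosure_eq_iUnion_pow, ← image_inv_eq_inv]
  exact isSigmaCompact_iUnion _
    (isSigmaCompact_pow (isSigmaCompact_union hS (hS.image continuous_inv)))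

theorem exists_isOpen_isSigmaCompact_subgroup [LocallyCompactSpace G] {S : Set G}
    (hS : IsSigmaCompact S) :
    ∃ H : Subgroup G, IsOpen (H : Set G) ∧ IsSigmaCompact (H : Set G) ∧ S ⊆ H := by
  obtain ⟨N, hN, hN₁⟩ := exists_compact_mem_nhds (1 : G)
  have hcl : N ∪ S ⊆ Subgroup.closure (N ∪ S) := Subgroup.subset_closure
  exact ⟨.closure (N ∪ S), Subgroup.isOpen_of_mem_nhds _ (g := 1)
      (Filter.mem_of_superset hN₁ (subset_union_left.trans hcl)),
    isSigmaCompact_subgroupClosure (isSigmaCompact_union hN.isSigmaCompact hS),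
    subset_union_right.trans hcl⟩

end SigmaCompact

section Haar

open Set Measure
open scoped ENNReal NNReal Pointwise

theorem sigmaFinite_restrict_of_isSigmaCompact {X : Type*} [TopologicalSpace X]
    [MeasurableSpace X] {μ : Measure X} [IsFiniteMeasureOnCompacts μ] {S : Set X}
    (hSm : MeasurableSet S) (hS : IsSigmaCompact S) : SigmaFinite (μ.restrict S) := by
  obtain ⟨K, hK, rfl⟩ := hS
  refine ⟨⟨⟨fun n => K n ∪ (⋃ n, K n)ᶜ, fun _ => trivial, fun n => ?_, ?_⟩⟩⟩
  · refine (measure_union_le _ _).trans_lt ?_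
    rw [Measure.restrict_apply hSm.compl, Set.compl_inter_self, measure_empty, add_zero]
    exact (Measure.restrict_apply_le _ _).trans_lt (hK n).measure_lt_top
  · rw [← iUnion_union, union_compl_self]

variable {G : Type*} [Group G] [TopologicalSpace G] [IsTopologicalGroup G]
  [LocallyCompactSpace G] [MeasurableSpace G] [BorelSpace G] {μ : Measure G}
  [μ.IsHaarMeasure]

/-- Only countably many cosets of a `σ`-compact open subgroup meet `U`. -/
theorem exists_isSigmaCompact_superset_of_isOpen {U : Set G} (hU : IsOpen U) (hμ : μ U ≠ ∞) :
    ∃ S : Set G, IsSigmaCompact S ∧ U ⊆ S := by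
  obtain ⟨H, hH, hHc, -⟩ := exists_isOpen_isSigmaCompact_subgroup (isSigmaCompact_empty (X := G))
  let A : G ⧸ H → Set G := fun q => U ∩ (QuotientGroup.mk ⁻¹' {q})
  have hcoset : ∀ q : G ⧸ H, (QuotientGroup.mk ⁻¹' {q} : Set G) = q.out • (H : Set G) := by
    intro q
    ext x
    rw [mem_preimage, mem_singleton_iff, mem_leftCoset_iff, SetLike.mem_coe,
      ← QuotientGroup.eq, QuotientGroup.out_eq', eq_comm]
  have hA : ∀ q, IsOpen (A q) := fun q => by
    simp only [A, hcoset]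
    exact hU.inter (hH.smul _)
  have hdisj : Pairwise (Function.onFun Disjoint A) := fun p q hpq =>
    Set.disjoint_left.2 fun x hx hx' => hpq (hx.2.symm.trans hx'.2)
  have hcount := countable_meas_pos_of_disjoint_of_meas_iUnion_ne_top (μ := μ)
    (As := A) (fun q => (hA q).measurableSet) hdisj
    (ne_top_of_le_ne_top hμ (measure_mono (iUnion_subset fun q => inter_subset_left)))
  refine ⟨⋃ q ∈ {q | 0 < μ (A q)}, q.out • (H : Set G),
    isSigmaCompact_biUnion hcount fun q _ => hHc.image (continuous_const_smul q.out),
    fun x hx => mem_iUnion₂.2 ⟨QuotientGroup.mk x, (hA _).measure_pos μ ⟨x, hx, rfl⟩, ?_⟩⟩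
  rw [← hcoset]
  rfl

variable [μ.Regular]

theorem exists_subgroup_of_measure_ne_top {s : ℕ → Set G} (hs : ∀ n, μ (s n) ≠ ∞) :
    ∃ H : Subgroup G, IsOpen (H : Set G) ∧ IsSigmaCompact (H : Set G) ∧ ∀ n, s n ⊆ H := by
  have hcover : ∀ n, ∃ S : Set G, IsSigmaCompact S ∧ s n ⊆ S := fun n => by
    obtain ⟨U, hsU, hU, hUμ⟩ := (s n).exists_isOpen_lt_of_lt ∞ (hs n).lt_top (μ := μ)
    obtain ⟨S, hS, hUS⟩ := exists_isSigmaCompact_superset_of_isOpen hU hUμ.ne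
    exact ⟨S, hS, hsU.trans hUS⟩
  choose S hS hsS using hcover
  obtain ⟨H, hH, hHc, hSH⟩ := exists_isOpen_isSigmaCompact_subgroup (isSigmaCompact_iUnion _ hS)
  exact ⟨H, hH, hHc, fun n => (hsS n).trans ((subset_iUnion S n).trans hSH)⟩

theorem exists_subgroup_of_lintegral_ne_top {f : G → ℝ≥0∞} (hf : Measurable f)
    (hfin : ∫⁻ x, f x ∂μ ≠ ∞) :
    ∃ H : Subgroup G, IsOpen (H : Set G) ∧ IsSigmaCompact (H : Set G) ∧ ∀ x ∉ H, f x = 0 := by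
  obtain ⟨H, hH, hHc, hs⟩ := exists_subgroup_of_measure_ne_top (μ := μ)
    (s := fun n : ℕ => {x | (n + 1 : ℝ≥0∞)⁻¹ ≤ f x}) fun n =>
      ((meas_ge_le_lintegral_div hf.aemeasurable (by simp) (by simp)).trans_lt
        (ENNReal.div_lt_top hfin (by simp))).ne
  refine ⟨H, hH, hHc, fun x hx => by_contra fun h₀ => ?_⟩
  obtain ⟨n, hn⟩ := ENNReal.exists_inv_nat_lt h₀
  exact hx (hs n ((ENNReal.inv_le_inv.2 le_self_add).trans hn.le))

variable (μ) in
theorem map_mul_right_eq_modularCharacterFun_smul (g : G) :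
    μ.map (· * g) = modularCharacterFun g • μ := by
  have : (μ.map (· * g)).Regular := Regular.map (Homeomorph.mulRight g)
  rw [modularCharacterFun_eq_haarScalarFactor μ g]
  exact isMulLeftInvariant_eq_smul_of_regular _ μ

theorem lintegral_mul_right_eq_modularCharacterFun_mul {f : G → ℝ≥0∞} (hf : Measurable f) (g : G) :
    ∫⁻ x, f (x * g) ∂μ = modularCharacterFun g * ∫⁻ x, f x ∂μ := by
  rw [← lintegral_map hf (measurable_mul_const g), map_mul_right_eq_modularCharacterFun_smul,
    lintegral_smul_measure]
  rfl

theorem continuous_modularCharacterFun :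
    Continuous fun g : G => (modularCharacterFun g : ℝ) := by
  obtain ⟨⟨f, hf⟩, hfc, hf₀, hf₁⟩ :
    ∃ f : C(G, ℝ), HasCompactSupport f ∧ 0 ≤ f ∧ f 1 ≠ 0 := exists_continuous_nonneg_pos 1
  have hpos : 0 < ∫ x, f x ∂haar :=
    hf.integral_pos_of_hasCompactSupport_nonneg_nonzero hfc hf₀ hf₁
  have hquot : ∀ g : G, (modularCharacterFun g : ℝ) =
      (∫ y, f (y⁻¹ * g) ∂haar.inv) / ∫ x, f x ∂haar := fun g => by
    rw [eq_div_iff hpos.ne', ← smul_eq_mul, ← NNReal.smul_def, ← integral_smul_nnreal_measure,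
      ← map_mul_right_eq_modularCharacterFun_smul,
      integral_map (measurable_mul_const g).aemeasurable hf.aestronglyMeasurable, Measure.inv,
      integral_map measurable_inv.aemeasurable (by fun_prop :
        Continuous fun y => f (y⁻¹ * g)).aestronglyMeasurable]
    simp only [inv_inv]
  simp_rw [hquot]
  exact (continuous_integral_apply_inv_mul hf hfc).div_const _

end Haar

/-! ### Integrals of functions supported in an open `σ`-compact subgroup -/

section SupportedIntegral

open Measure
open scoped ENNReal

theorem setLIntegral_eq_lintegral_of_forall_notMem {X : Type*} [MeasurableSpace X]
    {μ : Measure X} {S : Set X} (hS : MeasurableSet S)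
    {f : X → ℝ≥0∞} (hf : ∀ x ∉ S, f x = 0) : ∫⁻ x in S, f x ∂μ = ∫⁻ x, f x ∂μ := by
  rw [← lintegral_indicator hS, Set.indicator_eq_self.2 (Function.support_subset_iff'.2 hf)]

variable {X : Type*} [TopologicalSpace X] [MeasurableSpace X] [BorelSpace X] {μ : Measure X}
  [μ.Regular] {S : Set X} (hSm : MeasurableSet S) (hSc : IsSigmaCompact S)

include hSm hSc

theorem measurable_lintegral_of_support {f : X → X → ℝ≥0∞}
    (hf : Measurable fun z : BorelProd X X => f z.fst z.snd) (h₀ : ∀ x, ∀ y ∉ S, f x y = 0) :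
    Measurable fun x => ∫⁻ y, f x y ∂μ := by
  have := sigmaFinite_restrict_of_isSigmaCompact (μ := μ) hSm hSc
  simpa only [fun x => setLIntegral_eq_lintegral_of_forall_notMem (μ := μ) hSm (h₀ x)]
    using BorelProd.measurable_lintegral_right (n := μ.restrict S) hf

theorem stronglyMeasurable_integral_of_support {E : Type*} [NormedAddCommGroup E]
    [NormedSpace ℝ E] {f : X → X → E}
    (hf : StronglyMeasurable fun z : BorelProd X X => f z.fst z.snd)
    (h₀ : ∀ x, ∀ y ∉ S, f x y = 0) : StronglyMeasurable fun x => ∫ y, f x y ∂μ := by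
  have := sigmaFinite_restrict_of_isSigmaCompact (μ := μ) hSm hSc
  simpa only [fun x => setIntegral_eq_integral_of_forall_compl_eq_zero (μ := μ) (h₀ x)]
    using BorelProd.stronglyMeasurable_integral_right (n := μ.restrict S) hf

theorem lintegral_lintegral_swap_of_support {f : X → X → ℝ≥0∞}
    (hf : Measurable fun z : BorelProd X X => f z.fst z.snd)
    (h₁ : ∀ x ∉ S, ∀ y, f x y = 0) (h₂ : ∀ x, ∀ y ∉ S, f x y = 0) :
    ∫⁻ x, ∫⁻ y, f x y ∂μ ∂μ = ∫⁻ y, ∫⁻ x, f x y ∂μ ∂μ := by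
  have := sigmaFinite_restrict_of_isSigmaCompact (μ := μ) hSm hSc
  have hset : ∀ {u : X → ℝ≥0∞}, (∀ x ∉ S, u x = 0) → ∫⁻ x in S, u x ∂μ = ∫⁻ x, u x ∂μ := fun hu =>
    setLIntegral_eq_lintegral_of_forall_notMem hSm hu
  have hswap := BorelProd.lintegral_lintegral_swap (m := μ.restrict S) (n := μ.restrict S) hf
  simp_rw [hset (h₂ _), hset fun x hx => h₁ x hx _] at hswap
  rwa [hset fun x hx => by simp only [h₁ x hx, lintegral_zero],
    hset fun y hy => by simp only [h₂ _ y hy, lintegral_zero]] at hswap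

theorem integral_integral_swap_of_support {E : Type*} [NormedAddCommGroup E]
    [NormedSpace ℝ E] {f : X → X → E}
    (hf : StronglyMeasurable fun z : BorelProd X X => f z.fst z.snd)
    (h₁ : ∀ x ∉ S, ∀ y, f x y = 0) (h₂ : ∀ x, ∀ y ∉ S, f x y = 0)
    (hfin : ∫⁻ x, ∫⁻ y, ‖f x y‖ₑ ∂μ ∂μ ≠ ∞) :
    ∫ x, ∫ y, f x y ∂μ ∂μ = ∫ y, ∫ x, f x y ∂μ ∂μ := by
  have := sigmaFinite_restrict_of_isSigmaCompact (μ := μ) hSm hSc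
  have hset : ∀ {u : X → E}, (∀ x ∉ S, u x = 0) → ∫ x in S, u x ∂μ = ∫ x, u x ∂μ := fun hu =>
    setIntegral_eq_integral_of_forall_compl_eq_zero hu
  have hswap := BorelProd.integral_integral_swap (m := μ.restrict S) (n := μ.restrict S) hf
    (ne_top_of_le_ne_top hfin ((setLIntegral_le_lintegral _ _).trans
      (lintegral_mono fun x => setLIntegral_le_lintegral _ _)))
  simp_rw [hset (h₂ _), hset fun x hx => h₁ x hx _] at hswap
  rwa [hset fun x hx => by simp only [h₁ x hx, integral_zero],
    hset fun y hy => by simp only [h₂ _ y hy, integral_zero]] at hswap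

end SupportedIntegral

section Inversion

open Measure
open scoped ENNReal

theorem mem_of_inv_mul_mem {G : Type*} [Group G] {H : Subgroup G} {x y : G} (hy : y ∈ H)
    (h : y⁻¹ * x ∈ H) : x ∈ H :=
  (H.mul_mem_cancel_left (H.inv_mem hy)).1 h

theorem mul_inv_mul_eq_zero {G R : Type*} [Group G] [MulZeroClass R] {H : Subgroup G} {u v : G → R}
    (hu₀ : ∀ x ∉ H, u x = 0) (hv₀ : ∀ x ∉ H, v x = 0) {x : G} (hx : x ∉ H) (y : G) :
    u y * v (y⁻¹ * x) = 0 := by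
  by_cases hy : y ∈ H
  · rw [hv₀ _ fun h => hx (mem_of_inv_mul_mem hy h), mul_zero]
  · rw [hu₀ y hy, zero_mul]

variable {G : Type*} [Group G] [TopologicalSpace G] [IsTopologicalGroup G] [MeasurableSpace G]
  [BorelSpace G]

theorem BorelProd.measurable_inv_mul : Measurable fun z : BorelProd G G => z.snd⁻¹ * z.fst :=
  (BorelProd.continuous_snd.inv.mul BorelProd.continuous_fst).measurable

theorem measurable_mul_inv_mul {u v : G → ℝ≥0∞} (hu : Measurable u) (hv : Measurable v) :
    Measurable fun z : BorelProd G G => u z.snd * v (z.snd⁻¹ * z.fst) :=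
  (hu.comp BorelProd.continuous_snd.measurable).mul (hv.comp BorelProd.measurable_inv_mul)

variable {μ : Measure G} [μ.Regular] {H : Subgroup G} (hH : IsOpen (H : Set G))
  (hHc : IsSigmaCompact (H : Set G)) {u v : G → ℝ≥0∞} (hu : Measurable u) (hv : Measurable v)
  (hu₀ : ∀ x ∉ H, u x = 0)

include hH hHc hu hv hu₀

theorem measurable_lintegral_mul_inv_mul : Measurable fun x => ∫⁻ y, u y * v (y⁻¹ * x) ∂μ :=
  measurable_lintegral_of_support hH.measurableSet hHc (measurable_mul_inv_mul hu hv)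
    fun x y hy => by rw [hu₀ y hy, zero_mul]

variable [μ.IsHaarMeasure] (hv₀ : ∀ x ∉ H, v x = 0)

include hv₀

theorem lintegral_lintegral_mul_inv_mul :
    ∫⁻ x, ∫⁻ y, u y * v (y⁻¹ * x) ∂μ ∂μ = (∫⁻ x, u x ∂μ) * ∫⁻ x, v x ∂μ := by
  have h₂ : ∀ x, ∀ y ∉ H, u y * v (y⁻¹ * x) = 0 := fun x y hy => by rw [hu₀ y hy, zero_mul]
  calc _ = ∫⁻ y, ∫⁻ x, u y * v (y⁻¹ * x) ∂μ ∂μ :=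
        lintegral_lintegral_swap_of_support hH.measurableSet hHc (measurable_mul_inv_mul hu hv)
          (fun x hx y => mul_inv_mul_eq_zero hu₀ hv₀ hx y) h₂
    _ = ∫⁻ y, u y * ∫⁻ x, v x ∂μ ∂μ := lintegral_congr fun y => by
        rw [lintegral_const_mul _ (by fun_prop), lintegral_mul_left_eq_self]
    _ = _ := lintegral_mul_const _ hu

theorem ae_lintegral_mul_inv_mul_lt_top (hu_fin : ∫⁻ x, u x ∂μ ≠ ∞)
    (hv_fin : ∫⁻ x, v x ∂μ ≠ ∞) : ∀ᵐ x ∂μ, ∫⁻ y, u y * v (y⁻¹ * x) ∂μ < ∞ := by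
  refine ae_lt_top (measurable_lintegral_mul_inv_mul hH hHc hu hv hu₀) ?_
  rw [lintegral_lintegral_mul_inv_mul hH hHc hu hv hu₀ hv₀]
  exact ENNReal.mul_ne_top hu_fin hv_fin

omit hu hv hu₀ hv₀

variable [LocallyCompactSpace G]

/-- Both sides are multiplied by the integral of some `k`, and `∫ k (y * x) dy` produces the
factor `modularCharacterFun x`. -/
theorem lintegral_modularCharacterFun_mul_inv {f : G → ℝ≥0∞} (hf : Measurable f)
    (hf₀ : ∀ x ∉ H, f x = 0) :
    ∫⁻ x, modularCharacterFun x * f x⁻¹ ∂μ = ∫⁻ x, f x ∂μ := by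
  obtain ⟨K, hK, h1K, hKH⟩ := exists_compact_subset hH H.one_mem
  set k : G → ℝ≥0∞ := (interior K).indicator 1
  have hk : Measurable k := measurable_one.indicator isOpen_interior.measurableSet
  have hk₀ : ∀ x ∉ H, k x = 0 := fun x hx =>
    Set.indicator_of_notMem (fun h => hx (hKH (interior_subset h))) _
  have hk_int : ∫⁻ x, k x ∂μ = μ (interior K) :=
    lintegral_indicator_one isOpen_interior.measurableSet
  have hpos : μ (interior K) ≠ 0 := (isOpen_interior.measure_pos μ ⟨1, h1K⟩).ne'
  have hfin : μ (interior K) ≠ ∞ :=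
    ((measure_mono interior_subset).trans_lt hK.measure_lt_top).ne
  have hmeas : Measurable fun z : BorelProd G G => f z.fst⁻¹ * k (z.snd * z.fst) :=
    (hf.comp BorelProd.continuous_fst.inv.measurable).mul
      (hk.comp (BorelProd.continuous_snd.mul BorelProd.continuous_fst).measurable)
  have h₁ : ∀ x ∉ H, ∀ y, f x⁻¹ * k (y * x) = 0 := fun x hx y => by
    rw [hf₀ _ (mt H.inv_mem_iff.1 hx), zero_mul]
  have h₂ : ∀ x, ∀ y ∉ H, f x⁻¹ * k (y * x) = 0 := fun x y hy => by
    by_cases hx : x ∈ H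
    · rw [hk₀ _ fun h => hy ((H.mul_mem_cancel_right hx).1 h), mul_zero]
    · exact h₁ x hx y
  refine (ENNReal.mul_right_inj hpos hfin).1 ?_
  calc μ (interior K) * ∫⁻ x, modularCharacterFun x * f x⁻¹ ∂μ
      = ∫⁻ x, ∫⁻ y, f x⁻¹ * k (y * x) ∂μ ∂μ := by
        rw [← lintegral_const_mul' _ _ hfin]
        refine lintegral_congr fun x => ?_
        rw [lintegral_const_mul _ (by fun_prop),
          lintegral_mul_right_eq_modularCharacterFun_mul hk, hk_int]
        ring
    _ = ∫⁻ y, ∫⁻ x, f x⁻¹ * k (y * x) ∂μ ∂μ :=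
        lintegral_lintegral_swap_of_support hH.measurableSet hHc hmeas h₁ h₂
    _ = ∫⁻ y, ∫⁻ x, k x * f (x⁻¹ * y) ∂μ ∂μ := lintegral_congr fun y => by
        rw [← lintegral_mul_left_eq_self _ y⁻¹]
        simp only [mul_inv_rev, inv_inv, mul_inv_cancel_left, mul_comm]
    _ = μ (interior K) * ∫⁻ x, f x ∂μ := by
        rw [lintegral_lintegral_mul_inv_mul hH hHc hk hf hk₀ hf₀, hk_int]

omit hH hHc

variable (μ)

theorem quasiMeasurePreserving_inv_haar : QuasiMeasurePreserving (Inv.inv : G → G) μ μ := by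
  refine ⟨measurable_inv, AbsolutelyContinuous.mk fun E hE h₀ => ?_⟩
  obtain ⟨H, hH, hHc, hEH⟩ := exists_subgroup_of_measure_ne_top (μ := μ) (s := fun _ => E)
    fun _ => h₀ ▸ ENNReal.zero_ne_top
  have hf : Measurable (E.indicator (1 : G → ℝ≥0∞)) := measurable_one.indicator hE
  have hzero := lintegral_modularCharacterFun_mul_inv (μ := μ) hH hHc hf
    fun x hx => Set.indicator_of_notMem (fun h => hx (hEH 0 h)) _
  have hδ : Measurable fun x : G => (modularCharacterFun x : ℝ≥0∞) :=
    (NNReal.isEmbedding_coe.continuous_iff.2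
      continuous_modularCharacterFun).measurable.coe_nnreal_ennreal
  have hm : Measurable fun x : G =>
      (modularCharacterFun x : ℝ≥0∞) * E.indicator (1 : G → ℝ≥0∞) x⁻¹ :=
    hδ.mul (hf.comp measurable_inv)
  rw [lintegral_indicator_one hE, h₀, lintegral_eq_zero_iff hm] at hzero
  rw [Measure.map_apply measurable_inv hE]
  refine measure_mono_null (fun x (hx : x⁻¹ ∈ E) => ?_) (ae_iff.1 hzero)
  simp [hx, (modularCharacterFun_pos x).ne']

theorem quasiMeasurePreserving_inv_mul_haar (x : G) :
    QuasiMeasurePreserving (fun y : G => y⁻¹ * x) μ μ := by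
  have hcomp := (quasiMeasurePreserving_inv_haar μ).comp
    (measurePreserving_mul_left μ x⁻¹).quasiMeasurePreserving
  simpa only [Function.comp_def, mul_inv_rev, inv_inv] using hcomp

end Inversion

/-! ### The algebra of a twisted action -/

section Multiplier

variable {B : Type*} [NonUnitalNormedRing B] [StarRing B] [NormedStarGroup B] [NormedSpace ℂ B]
  [IsScalarTower ℂ B B] [SMulCommClass ℂ B B] [StarModule ℂ B]

namespace IsUnitaryMultiplier

variable {u v w : 𝓜(ℂ, B)}

theorem norm_snd_le (hu : IsUnitaryMultiplier u) (b : B) : ‖u.snd b‖ ≤ ‖b‖ := by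
  have h : ‖u.snd‖ ≤ 1 := (le_max_right ‖u.fst‖ ‖u.snd‖).trans hu.norm_le_one
  exact (u.snd.le_opNorm b).trans (mul_le_of_le_one_left (norm_nonneg _) h)

theorem star_fst_fst (hu : IsUnitaryMultiplier u) (b : B) : (star u).fst (u.fst b) = b := by
  have h := congrArg (fun m : 𝓜(ℂ, B) => m.fst b) hu.star_mul_self
  simpa using h

theorem snd_star_snd (hu : IsUnitaryMultiplier u) (b : B) : u.snd ((star u).snd b) = b := by
  have h := congrArg (fun m : 𝓜(ℂ, B) => m.snd b) hu.star_mul_self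
  simpa using h

theorem snd_star_fst (hu : IsUnitaryMultiplier u) (b : B) : u.snd (star (u.fst b)) = star b := by
  have h := hu.snd_star_snd (star b)
  rwa [DoubleCentralizer.star_snd, star_star] at h

theorem star_fst_mul (hu : IsUnitaryMultiplier u) (a b : B) :
    (star u).fst (a * b) = (star u).fst a * b := by
  simp [DoubleCentralizer.star_fst, hu.snd_mul]

theorem star_snd_mul_star_snd (hv : IsUnitaryMultiplier v)
    (hw : IsUnitaryMultiplier w) (b c : B) :
    star (w.snd c) * v.snd (star (u.snd (v.fst b))) = star (w.snd (u.fst c)) * star b := by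
  apply star_injective
  rw [star_mul, star_mul, star_star, star_star, star_star]
  have h1 : star (v.snd (star (u.snd (v.fst b)))) = (star v).fst (u.snd (v.fst b)) :=
    (DoubleCentralizer.star_fst v _).symm
  rw [h1, ← hv.star_fst_mul, u.central, ← hv.fst_mul, hv.star_fst_fst, ← u.central,
    ← hw.snd_mul, u.central, hw.snd_mul]

end IsUnitaryMultiplier

end Multiplier

namespace TwistedAction

section Algebra

variable {G B : Type*} [Group G] [TopologicalSpace G]
  [NonUnitalNormedRing B] [StarRing B] [NormedStarGroup B] [NormedSpace ℂ B]
  [IsScalarTower ℂ B B] [SMulCommClass ℂ B B] [StarModule ℂ B] (T : TwistedAction G B)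

/-- The product `a α_p(b) ω(p, q)` of an element `a` over `p` and an element `b` over `q`. -/
noncomputable def fiberMul (p q : G) (a b : B) : B := (T.ω p q).snd (a * T.α p b)

/-- The adjoint `ω(p, p⁻¹)^* α_p(a^*)`, over `p`, of an element `a` over `p⁻¹`. -/
noncomputable def fiberStar (p : G) (a : B) : B := star ((T.ω p p⁻¹).snd (T.α p a))

theorem cocycle_snd (x y z : G) (c : B) :
    (T.ω x (y * z)).snd (T.α x ((T.ω y z).snd c)) =
      (T.ω (x * y) z).snd ((T.ω x y).snd (T.α x c)) := by
  have h := congrArg (fun m : 𝓜(ℂ, B) => m.snd (T.α x c)) (T.cocycle x y z)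
  simpa [multiplierMap, isometricAutCLM] using h

theorem α_snd_inv (x : G) (c : B) :
    T.α x ((T.ω x⁻¹ x).snd c) = (T.ω x x⁻¹).snd (T.α x c) := by
  have h := T.cocycle_snd x x⁻¹ x c
  simpa [T.ω_one_right, T.ω_one_left] using h

theorem fiberMul_assoc (p q r : G) (a b c : B) :
    T.fiberMul (p * q) r (T.fiberMul p q a b) c = T.fiberMul p (q * r) a (T.fiberMul q r b c) := by
  simp only [fiberMul]
  rw [(T.unitary_ω p (q * r)).snd_mul, T.cocycle_snd, map_mul (T.α p),
    (T.unitary_ω p q).snd_mul (T.α p b), T.twist, ← (T.ω p q).central,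
    ← (T.unitary_ω (p * q) r).snd_mul a, ← mul_assoc, ← (T.unitary_ω p q).snd_mul]

theorem fiberStar_fiberStar (p : G) (a : B) : T.fiberStar p (T.fiberStar p⁻¹ a) = a := by
  simp only [fiberStar, inv_inv]
  rw [map_star, T.α_snd_inv, T.twist, mul_inv_cancel, T.α_one, (T.unitary_ω _ _).snd_star_fst,
    star_star]

theorem fiberStar_fiberMul (x y : G) (a b : B) :
    T.fiberStar x (T.fiberMul y (y⁻¹ * x⁻¹) b a) =
      T.fiberMul (x * y) y⁻¹ (T.fiberStar (x * y) a) (T.fiberStar y⁻¹ b) := by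
  have hxy : x * y * y⁻¹ = x := by group
  have h1 := T.cocycle_snd x y (y⁻¹ * x⁻¹) (b * T.α y a)
  have h2 := T.cocycle_snd (x * y) y⁻¹ y (T.α y⁻¹ b)
  rw [mul_inv_cancel_left] at h1
  rw [inv_mul_cancel, T.ω_one_right, T.twist, hxy] at h2
  rw [DoubleCentralizer.one_snd] at h2
  change T.α (x * y) _ = _ at h2
  simp only [fiberMul, fiberStar, inv_inv]
  rw [h1, map_mul (T.α x), (T.unitary_ω x y).snd_mul, (T.unitary_ω (x * y) _).snd_mul, T.twist,
    star_mul, (T.unitary_ω (x * y) y⁻¹).snd_mul, map_star, h2, mul_inv_rev,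
    (T.unitary_ω (x * y) y⁻¹).star_snd_mul_star_snd (T.unitary_ω (x * y) _)]

theorem norm_fiberMul_le (p q : G) (a b : B) : ‖T.fiberMul p q a b‖ ≤ ‖a‖ * ‖b‖ :=
  ((T.unitary_ω p q).norm_snd_le _).trans ((norm_mul_le _ _).trans_eq (by rw [T.norm_α]))

theorem enorm_fiberMul_le (p q : G) (a b : B) : ‖T.fiberMul p q a b‖ₑ ≤ ‖a‖ₑ * ‖b‖ₑ := by
  simp only [← ofReal_norm, ← ENNReal.ofReal_mul (norm_nonneg a)]
  exact ENNReal.ofReal_le_ofReal (T.norm_fiberMul_le p q a b)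

theorem norm_fiberStar_le (p : G) (a : B) : ‖T.fiberStar p a‖ ≤ ‖a‖ := by
  rw [fiberStar, norm_star]
  exact ((T.unitary_ω _ _).norm_snd_le _).trans_eq (T.norm_α _ _)

/-- The map `a ↦ a α_p(b) ω(p, q)`, a continuous linear map of the left factor `a`. -/
noncomputable def fiberMulLeft (p q : G) (b : B) : B →L[ℂ] B :=
  LinearMap.mkContinuous
    { toFun := fun a => T.fiberMul p q a b
      map_add' := fun a a' => by simp [fiberMul, add_mul]
      map_smul' := fun z a => by simp [fiberMul, smul_mul_assoc] } ‖b‖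
    (fun a => (T.norm_fiberMul_le p q a b).trans_eq (mul_comm _ _))

/-- The map `b ↦ a α_p(b) ω(p, q)`, a continuous linear map of the right factor `b`. -/
noncomputable def fiberMulRight (p q : G) (a : B) : B →L[ℂ] B :=
  LinearMap.mkContinuous
    { toFun := fun b => T.fiberMul p q a b
      map_add' := fun b b' => by simp [fiberMul, mul_add]
      map_smul' := fun z b => by simp [fiberMul, mul_smul_comm] } ‖a‖
    (fun b => T.norm_fiberMul_le p q a b)

theorem fiberMul_add_left (p q : G) (a a' b : B) :
    T.fiberMul p q (a + a') b = T.fiberMul p q a b + T.fiberMul p q a' b :=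
  map_add (T.fiberMulLeft p q b) a a'

theorem fiberMul_add_right (p q : G) (a b b' : B) :
    T.fiberMul p q a (b + b') = T.fiberMul p q a b + T.fiberMul p q a b' :=
  map_add (T.fiberMulRight p q a) b b'

theorem fiberMul_smul_left (p q : G) (z : ℂ) (a b : B) :
    T.fiberMul p q (z • a) b = z • T.fiberMul p q a b :=
  map_smul (T.fiberMulLeft p q b) z a

theorem fiberMul_smul_right (p q : G) (z : ℂ) (a b : B) :
    T.fiberMul p q a (z • b) = z • T.fiberMul p q a b :=
  map_smul (T.fiberMulRight p q a) z b

theorem fiberMul_zero_left (p q : G) (b : B) : T.fiberMul p q 0 b = 0 :=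
  map_zero (T.fiberMulLeft p q b)

theorem fiberMul_zero_right (p q : G) (a : B) : T.fiberMul p q a 0 = 0 :=
  map_zero (T.fiberMulRight p q a)

theorem fiberStar_add (p : G) (a b : B) :
    T.fiberStar p (a + b) = T.fiberStar p a + T.fiberStar p b := by
  simp [fiberStar]

theorem fiberStar_smul (p : G) (z : ℂ) (a : B) :
    T.fiberStar p (z • a) = (starRingEnd ℂ z) • T.fiberStar p a := by
  simp [fiberStar, star_smul]

theorem fiberStar_zero (p : G) : T.fiberStar p 0 = 0 := by
  simp [fiberStar]

/-- `fiberStar` as a continuous map; it is conjugate linear, hence linear over `ℝ` only. -/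
noncomputable def fiberStarL (p : G) : B →L[ℝ] B :=
  LinearMap.mkContinuous
    { toFun := T.fiberStar p
      map_add' := T.fiberStar_add p
      map_smul' := fun r a => by
        have h := T.fiberStar_smul p (r : ℂ) a
        rw [Complex.conj_ofReal, Complex.coe_smul, Complex.coe_smul] at h
        exact h } 1
    (fun a => by simpa using T.norm_fiberStar_le p a)

end Algebra

section Restrict

variable {G A B : Type*} [Group G] [TopologicalSpace G]
  [NonUnitalNormedRing A] [StarRing A] [NormedStarGroup A] [NormedSpace ℂ A]
  [IsScalarTower ℂ A A] [SMulCommClass ℂ A A] [StarModule ℂ A]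
  [NonUnitalNormedRing B] [StarRing B] [NormedStarGroup B] [NormedSpace ℂ B]
  [IsScalarTower ℂ B B] [SMulCommClass ℂ B B] [StarModule ℂ B]
  {T : TwistedAction G B} {ι : A →L[ℂ] B} {S : TwistedAction G A}

theorem RestrictsTo.map_fiberMul (h : T.RestrictsTo ι S) (hmul : ∀ a b, ι (a * b) = ι a * ι b)
    (p q : G) (a b : A) : ι (S.fiberMul p q a b) = T.fiberMul p q (ι a) (ι b) := by
  simp only [fiberMul]
  rw [h.map_ω_snd, hmul, h.map_α]

theorem RestrictsTo.map_fiberStar (h : T.RestrictsTo ι S) (hstar : ∀ a, ι (star a) = star (ι a))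
    (p : G) (a : A) : ι (S.fiberStar p a) = T.fiberStar p (ι a) := by
  simp only [fiberStar]
  rw [hstar, h.map_ω_snd, h.map_α]

end Restrict

end TwistedAction

/-! ### Measurability -/

section Measurability

open Filter Set

section Caratheodory

variable {Z E F : Type*} [MeasurableSpace Z] [TopologicalSpace F] [AddCommMonoid F]
  [ContinuousAdd F] {L : Z → E → F}

theorem stronglyMeasurable_apply_simpleFunc (hL : ∀ b, StronglyMeasurable fun z => L z b)
    (f : SimpleFunc Z E) : StronglyMeasurable fun z => L z (f z) := by
  have hsum : (fun z => L z (f z)) =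
      fun z => ∑ c ∈ f.range, (f ⁻¹' {c}).indicator (fun z => L z c) z := by
    ext z
    exact ((Finset.sum_eq_single_of_mem (f z) (f.mem_range_self z) fun c _ hc =>
      indicator_of_notMem (mt Eq.symm hc) _).trans (indicator_of_mem rfl _)).symm
  rw [hsum]
  exact Finset.stronglyMeasurable_fun_sum _ fun c _ => (hL c).indicator (f.measurableSet_fiber c)

variable [TopologicalSpace E] [TopologicalSpace.PseudoMetrizableSpace F]

theorem stronglyMeasurable_apply_of_continuous (hLc : ∀ z, Continuous (L z))
    (hL : ∀ b, StronglyMeasurable fun z => L z b) {f : Z → E} (hf : StronglyMeasurable f) :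
    StronglyMeasurable fun z => L z (f z) :=
  stronglyMeasurable_of_tendsto atTop
    (fun n => stronglyMeasurable_apply_simpleFunc hL (hf.approx n))
    (tendsto_pi_nhds.2 fun z => ((hLc z).tendsto _).comp (hf.tendsto_approx z))

theorem stronglyMeasurable_indicator_apply_of_continuous {R : Set Z}
    (hLc : ∀ z, Continuous (L z)) (hL : ∀ b, StronglyMeasurable (R.indicator fun z => L z b))
    {f : Z → E} (hf : StronglyMeasurable f) :
    StronglyMeasurable (R.indicator fun z => L z (f z)) := by
  classical
  have hLc' : ∀ z, Continuous fun b => R.indicator (fun z => L z b) z := fun z => by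
    by_cases hz : z ∈ R <;> simp [hz, hLc, continuous_const]
  exact stronglyMeasurable_apply_of_continuous hLc' hL hf

end Caratheodory

theorem IsStronglyBorel.stronglyMeasurable_indicator {X E : Type*} [TopologicalSpace X]
    [MeasurableSpace X] [BorelSpace X] [TopologicalSpace E]
    [TopologicalSpace.PseudoMetrizableSpace E] [Zero E] {f : X → E} (hf : IsStronglyBorel f)
    {R : Set X} (hR : MeasurableSet R) (hRc : IsSigmaCompact R) :
    StronglyMeasurable (R.indicator f) := by
  borelize E
  have hm : Measurable f := by
    have h := hf.1
    rwa [← BorelSpace.measurable_eq (α := X)] at h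
  obtain ⟨K, hK, rfl⟩ := hRc
  have hsep : TopologicalSpace.IsSeparable (f '' (⋃ n, K n) ∪ {0}) := by
    rw [image_iUnion]
    exact (TopologicalSpace.IsSeparable.iUnion fun n => hf.2 _ (hK n)).union
      (finite_singleton 0).isSeparable
  refine stronglyMeasurable_iff_measurable_separable.2 ⟨hm.indicator hR, hsep.mono ?_⟩
  rintro _ ⟨x, rfl⟩
  by_cases hx : x ∈ ⋃ n, K n
  · exact Or.inl ⟨x, hx, (indicator_of_mem hx f).symm⟩
  · exact Or.inr (indicator_of_notMem hx f)

namespace TwistedAction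

variable {G B : Type*} [Group G] [TopologicalSpace G]
  [NonUnitalNormedRing B] [StarRing B] [NormedStarGroup B] [NormedSpace ℂ B]
  [IsScalarTower ℂ B B] [SMulCommClass ℂ B B] [StarModule ℂ B] (T : TwistedAction G B)
  {H : Set G} (hH : IsOpen H) (hHc : IsSigmaCompact H) {Z : Type*} [MeasurableSpace Z]

include hH hHc

theorem stronglyMeasurable_indicator_α [MeasurableSpace G] [BorelSpace G] {p : Z → G}
    (hp : Measurable p) {f : Z → B} (hf : StronglyMeasurable f) :
    StronglyMeasurable ((p ⁻¹' H).indicator fun z => T.α (p z) (f z)) :=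
  stronglyMeasurable_indicator_apply_of_continuous (L := fun z b => T.α (p z) b)
    (fun z => (isometricAutCLM (T.α (p z)) (T.norm_α _)).continuous)
    (fun b => ((T.borel_α b).stronglyMeasurable_indicator hH.measurableSet hHc).comp_measurable hp)
    hf

theorem stronglyMeasurable_ω_snd {p q : Z → G}
    (hpq : Measurable fun z => BorelProd.mk (p z) (q z)) {f : Z → B}
    (hf : StronglyMeasurable f) (hf₀ : ∀ z, ¬ (p z ∈ H ∧ q z ∈ H) → f z = 0) :
    StronglyMeasurable fun z => (T.ω (p z) (q z)).snd (f z) := by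
  set R : Set (BorelProd G G) := H ×ˢ H
  have hR : IsOpen R := hH.prod hH
  have hRc : IsSigmaCompact R := isSigmaCompact_prod hHc hHc
  have hω : ∀ b, IsStronglyBorel fun z : BorelProd G G => (T.ω z.fst z.snd).snd b := T.borel_ω_snd
  have hind := stronglyMeasurable_indicator_apply_of_continuous
    (L := fun z b => (T.ω (p z) (q z)).snd b) (R := (fun z => BorelProd.mk (p z) (q z)) ⁻¹' R)
    (fun z => (T.ω (p z) (q z)).snd.continuous)
    (fun b => ((hω b).stronglyMeasurable_indicator hR.measurableSet hRc).comp_measurable hpq) hf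
  rwa [indicator_eq_self.2] at hind
  refine Function.support_subset_iff'.2 fun z hz => ?_
  rw [hf₀ z hz, map_zero]

variable [MeasurableSpace G] [BorelSpace G]

theorem stronglyMeasurable_fiberMul {p q : Z → G}
    (hpq : Measurable fun z => BorelProd.mk (p z) (q z)) {f g : Z → B}
    (hf : StronglyMeasurable f) (hg : StronglyMeasurable g)
    (hf₀ : ∀ z, p z ∉ H → f z = 0) (hg₀ : ∀ z, q z ∉ H → g z = 0) :
    StronglyMeasurable fun z => T.fiberMul (p z) (q z) (f z) (g z) := by
  have hp : Measurable p := BorelProd.continuous_fst.measurable.comp hpq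
  have hmul : StronglyMeasurable fun z => f z * T.α (p z) (g z) := by
    convert hf.mul (T.stronglyMeasurable_indicator_α hH hHc hp hg) using 1
    ext z
    by_cases hz : p z ∈ H
    · rw [Pi.mul_apply, indicator_of_mem (mem_preimage.2 hz)]
    · rw [Pi.mul_apply, hf₀ z hz, zero_mul, zero_mul]
  refine T.stronglyMeasurable_ω_snd hH hHc hpq hmul fun z hz => ?_
  by_cases hpz : p z ∈ H
  · rw [hg₀ z fun h => hz ⟨hpz, h⟩, map_zero, mul_zero]
  · rw [hf₀ z hpz, zero_mul]

theorem stronglyMeasurable_fiberStar {p : Z → G}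
    (hpq : Measurable fun z => BorelProd.mk (p z) (p z)⁻¹) {f : Z → B}
    (hf : StronglyMeasurable f) (hf₀ : ∀ z, ¬ (p z ∈ H ∧ (p z)⁻¹ ∈ H) → f z = 0) :
    StronglyMeasurable fun z => T.fiberStar (p z) (f z) := by
  have hp : Measurable p := BorelProd.continuous_fst.measurable.comp hpq
  have hα : StronglyMeasurable fun z => T.α (p z) (f z) := by
    have hind := T.stronglyMeasurable_indicator_α hH hHc hp hf
    rwa [indicator_eq_self.2] at hind
    refine Function.support_subset_iff'.2 fun z hz => ?_
    rw [hf₀ z fun h => hz h.1, map_zero]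
  exact continuous_star.comp_stronglyMeasurable <|
    T.stronglyMeasurable_ω_snd hH hHc hpq hα fun z hz => by rw [hf₀ z hz, map_zero]

end TwistedAction

end Measurability

/-! ### Convolution and involution of functions supported in a subgroup -/

/-- The functions with which the operations of `L¹` are computed: strongly measurable, integrable
and zero off the set `H`, in practice an open `σ`-compact subgroup. Every integrable function
agrees almost everywhere with such a function. -/
structure IsIntegrableIn {G E : Type*} [MeasurableSpace G] [NormedAddCommGroup E]
    (μ : Measure G) (H : Set G) (f : G → E) : Prop where
  stronglyMeasurable : StronglyMeasurable f
  integrable : Integrable f μ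
  eq_zero : ∀ x ∉ H, f x = 0

theorem IsIntegrableIn.enorm_eq_zero {G E : Type*} [MeasurableSpace G] [NormedAddCommGroup E]
    {μ : Measure G} {H : Set G} {f : G → E} (hf : IsIntegrableIn μ H f) :
    ∀ x ∉ H, ‖f x‖ₑ = 0 := fun x hx => by
  rw [hf.eq_zero x hx, enorm_zero]

namespace TwistedAction

section Functions

open Measure
open scoped ENNReal

variable {G B : Type*} [Group G] [TopologicalSpace G]
  [NonUnitalNormedRing B] [StarRing B] [NormedStarGroup B] [NormedSpace ℂ B]
  [IsScalarTower ℂ B B] [SMulCommClass ℂ B B] [StarModule ℂ B] (T : TwistedAction G B)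

theorem convIntegrand_eq_fiberMul (f g : G → B) (x y : G) :
    T.convIntegrand f g x y = T.fiberMul y (y⁻¹ * x) (f y) (g (y⁻¹ * x)) := rfl

theorem enorm_convIntegrand_le (f g : G → B) (x y : G) :
    ‖T.convIntegrand f g x y‖ₑ ≤ ‖f y‖ₑ * ‖g (y⁻¹ * x)‖ₑ :=
  T.enorm_fiberMul_le _ _ _ _

/-- The integrand of `(f * g) * h` at `x` as a double integral over `y` and `z`. -/
noncomputable def convConvIntegrand (f g h : G → B) (x y z : G) : B :=
  T.fiberMul y (y⁻¹ * x) (T.convIntegrand f g y z) (h (y⁻¹ * x))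

theorem convConvIntegrand_mul (f g h : G → B) (x z w : G) :
    T.convConvIntegrand f g h x (z * w) z =
      T.fiberMul z (z⁻¹ * x) (f z) (T.convIntegrand g h (z⁻¹ * x) w) := by
  have hcancel : w * (w⁻¹ * (z⁻¹ * x)) = z⁻¹ * x := mul_inv_cancel_left w _
  rw [convConvIntegrand, convIntegrand_eq_fiberMul, convIntegrand_eq_fiberMul,
    inv_mul_cancel_left, mul_inv_rev, mul_assoc, fiberMul_assoc, hcancel]

theorem enorm_convConvIntegrand_le (f g h : G → B) (x y z : G) :
    ‖T.convConvIntegrand f g h x y z‖ₑ ≤ ‖f z‖ₑ * ‖g (z⁻¹ * y)‖ₑ * ‖h (y⁻¹ * x)‖ₑ :=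
  (T.enorm_fiberMul_le _ _ _ _).trans (by gcongr; exact T.enorm_convIntegrand_le f g y z)

theorem fiberStar_convIntegrand (f g : G → B) (x y : G) :
    T.fiberStar x (T.convIntegrand f g x⁻¹ y) =
      T.fiberMul (x * y) ((x * y)⁻¹ * x) (T.fiberStar (x * y) (g (x * y)⁻¹))
        (T.fiberStar ((x * y)⁻¹ * x) (f ((x * y)⁻¹ * x)⁻¹)) := by
  have hinv : (x * y)⁻¹ * x = y⁻¹ := by group
  rw [convIntegrand_eq_fiberMul, fiberStar_fiberMul, hinv, inv_inv, mul_inv_rev]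

section Modular

variable [IsTopologicalGroup G] [LocallyCompactSpace G]

theorem modularFunction_inv (x : G) : modularFunction G x⁻¹ = modularCharacterFun x := by
  rw [modularFunction, inv_inv]

theorem modularCharacterFun_mul_inv_self (x : G) :
    (modularCharacterFun x : ℂ) * (modularCharacterFun x⁻¹ : ℂ) = 1 := by
  have hmul := modularCharacterFun_map_mul x x⁻¹
  rw [mul_inv_cancel, modularCharacterFun_map_one] at hmul
  exact_mod_cast congrArg (fun r : NNReal => ((r : ℝ) : ℂ)) hmul.symm

theorem invol_eq_smul_fiberStar (f : G → B) (x : G) :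
    T.invol f x = (modularCharacterFun x : ℂ) • T.fiberStar x (f x⁻¹) := by
  rw [invol, modularFunction_inv, fiberStar, DoubleCentralizer.star_fst, map_star (T.α x),
    star_star]

theorem enorm_invol_le (f : G → B) (x : G) :
    ‖T.invol f x‖ₑ ≤ modularCharacterFun x * ‖f x⁻¹‖ₑ := by
  have hle : ‖T.invol f x‖₊ ≤ modularCharacterFun x * ‖f x⁻¹‖₊ := by
    rw [invol_eq_smul_fiberStar, ← NNReal.coe_le_coe, coe_nnnorm, norm_smul]
    simpa using mul_le_mul_of_nonneg_left (T.norm_fiberStar_le x (f x⁻¹)) (NNReal.coe_nonneg _)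
  exact (ENNReal.coe_le_coe.2 hle).trans_eq (ENNReal.coe_mul _ _)

theorem invol_invol (f : G → B) : T.invol (T.invol f) = f := by
  ext x
  rw [invol_eq_smul_fiberStar, invol_eq_smul_fiberStar, fiberStar_smul, Complex.conj_ofReal,
    smul_smul, inv_inv, fiberStar_fiberStar, modularCharacterFun_mul_inv_self, one_smul]

theorem convIntegrand_invol_invol (f g : G → B) (x y : G) :
    T.convIntegrand (T.invol g) (T.invol f) x y = (modularCharacterFun x : ℂ) •
      T.fiberMul y (y⁻¹ * x) (T.fiberStar y (g y⁻¹))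
        (T.fiberStar (y⁻¹ * x) (f (y⁻¹ * x)⁻¹)) := by
  rw [convIntegrand_eq_fiberMul, invol_eq_smul_fiberStar, invol_eq_smul_fiberStar,
    fiberMul_smul_left, fiberMul_smul_right, smul_smul, ← Complex.ofReal_mul, ← NNReal.coe_mul,
    ← modularCharacterFun_map_mul, mul_inv_cancel_left]

end Modular

variable [MeasurableSpace G] {μ : Measure G} {H : Subgroup G} {f g h : G → B}

theorem convIntegrand_eq_zero_of_right (hf : IsIntegrableIn μ H f) (x : G) {y : G} (hy : y ∉ H) :
    T.convIntegrand f g x y = 0 := by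
  rw [convIntegrand_eq_fiberMul, hf.eq_zero y hy, fiberMul_zero_left]

theorem convIntegrand_eq_zero_of_left (hf : IsIntegrableIn μ H f) (hg : IsIntegrableIn μ H g)
    {x : G} (hx : x ∉ H) (y : G) : T.convIntegrand f g x y = 0 := by
  by_cases hy : y ∈ H
  · rw [convIntegrand_eq_fiberMul, hg.eq_zero _ fun h => hx (mem_of_inv_mul_mem hy h),
      fiberMul_zero_right]
  · exact T.convIntegrand_eq_zero_of_right hf x hy

section Congr

variable [IsTopologicalGroup G] [BorelSpace G] [LocallyCompactSpace G] [μ.IsHaarMeasure]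
  [μ.Regular] {f' g' : G → B}

theorem convIntegrand_congr_ae (hf : f =ᵐ[μ] f') (hg : g =ᵐ[μ] g') (x : G) :
    T.convIntegrand f g x =ᵐ[μ] T.convIntegrand f' g' x := by
  filter_upwards [hf, (quasiMeasurePreserving_inv_mul_haar μ x).ae hg] with y hfy hgy
  rw [convIntegrand_eq_fiberMul, convIntegrand_eq_fiberMul, hfy, hgy]

theorem conv_congr_ae (hf : f =ᵐ[μ] f') (hg : g =ᵐ[μ] g') : T.conv μ f g = T.conv μ f' g' :=
  funext fun x => integral_congr_ae (T.convIntegrand_congr_ae hf hg x)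

end Congr

section Convolution

variable [IsTopologicalGroup G] [BorelSpace G] (hH : IsOpen (H : Set G))
  (hHc : IsSigmaCompact (H : Set G)) (hf : IsIntegrableIn μ H f) (hg : IsIntegrableIn μ H g)

include hH hHc hf hg

theorem stronglyMeasurable_convIntegrand :
    StronglyMeasurable fun z : BorelProd G G => T.convIntegrand f g z.fst z.snd :=
  T.stronglyMeasurable_fiberMul hH hHc
    (BorelProd.continuous_mk BorelProd.continuous_snd
      (BorelProd.continuous_snd.inv.mul BorelProd.continuous_fst)).measurable
    (hf.stronglyMeasurable.comp_measurable BorelProd.continuous_snd.measurable)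
    (hg.stronglyMeasurable.comp_measurable BorelProd.measurable_inv_mul)
    (fun _ hz => hf.eq_zero _ hz) (fun _ hz => hg.eq_zero _ hz)

variable [μ.IsHaarMeasure] [μ.Regular]

theorem lintegral_lintegral_convIntegrand_le :
    ∫⁻ x, ∫⁻ y, ‖T.convIntegrand f g x y‖ₑ ∂μ ∂μ ≤ (∫⁻ x, ‖f x‖ₑ ∂μ) * ∫⁻ x, ‖g x‖ₑ ∂μ := by
  rw [← lintegral_lintegral_mul_inv_mul hH hHc hf.stronglyMeasurable.enorm
    hg.stronglyMeasurable.enorm hf.enorm_eq_zero hg.enorm_eq_zero]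
  exact lintegral_mono fun x => lintegral_mono fun y => T.enorm_convIntegrand_le f g x y

theorem ae_integrable_convIntegrand : ∀ᵐ x ∂μ, Integrable (T.convIntegrand f g x) μ := by
  filter_upwards [ae_lintegral_mul_inv_mul_lt_top hH hHc hf.stronglyMeasurable.enorm
    hg.stronglyMeasurable.enorm hf.enorm_eq_zero hg.enorm_eq_zero hf.integrable.2.ne
    hg.integrable.2.ne] with x hx
  exact ⟨((T.stronglyMeasurable_convIntegrand hH hHc hf hg).comp_measurable
      (BorelProd.measurable_mk_left x)).aestronglyMeasurable,
    (lintegral_mono fun y => T.enorm_convIntegrand_le f g x y).trans_lt hx⟩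

theorem lintegral_enorm_conv_le :
    ∫⁻ x, ‖T.conv μ f g x‖ₑ ∂μ ≤ (∫⁻ x, ‖f x‖ₑ ∂μ) * ∫⁻ x, ‖g x‖ₑ ∂μ :=
  (lintegral_mono fun _ => enorm_integral_le_lintegral_enorm _).trans
    (T.lintegral_lintegral_convIntegrand_le hH hHc hf hg)

theorem isIntegrableIn_conv : IsIntegrableIn μ H (T.conv μ f g) where
  stronglyMeasurable := stronglyMeasurable_integral_of_support hH.measurableSet hHc
    (T.stronglyMeasurable_convIntegrand hH hHc hf hg)
    fun x y hy => T.convIntegrand_eq_zero_of_right hf x hy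
  integrable := ⟨(stronglyMeasurable_integral_of_support hH.measurableSet hHc
      (T.stronglyMeasurable_convIntegrand hH hHc hf hg)
      fun x y hy => T.convIntegrand_eq_zero_of_right hf x hy).aestronglyMeasurable,
    (T.lintegral_enorm_conv_le hH hHc hf hg).trans_lt
      (ENNReal.mul_lt_top hf.integrable.2 hg.integrable.2)⟩
  eq_zero x hx := by
    simp only [conv, T.convIntegrand_eq_zero_of_left hf hg hx, integral_zero]

end Convolution

section Associativity

variable [IsTopologicalGroup G] [BorelSpace G] (hH : IsOpen (H : Set G))
  (hHc : IsSigmaCompact (H : Set G)) (hf : IsIntegrableIn μ H f) (hg : IsIntegrableIn μ H g)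

include hH hHc hf hg

theorem stronglyMeasurable_convConvIntegrand (hh : IsIntegrableIn μ H h) (x : G) :
    StronglyMeasurable fun w : BorelProd G G => T.convConvIntegrand f g h x w.fst w.snd := by
  have hcont : Continuous fun w : BorelProd G G => w.fst⁻¹ * x :=
    BorelProd.continuous_fst.inv.mul continuous_const
  exact T.stronglyMeasurable_fiberMul hH hHc
    (BorelProd.continuous_mk BorelProd.continuous_fst hcont).measurable
    (T.stronglyMeasurable_convIntegrand hH hHc hf hg)
    (hh.stronglyMeasurable.comp_measurable hcont.measurable)
    (fun w hw => T.convIntegrand_eq_zero_of_left hf hg hw _) (fun w hw => hh.eq_zero _ hw)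

variable [μ.IsHaarMeasure] [μ.Regular]

theorem ae_lintegral_convConvIntegrand_ne_top (hh : IsIntegrableIn μ H h) :
    ∀ᵐ x ∂μ, ∫⁻ y, ∫⁻ z, ‖T.convConvIntegrand f g h x y z‖ₑ ∂μ ∂μ ≠ ∞ := by
  have hu := hf.stronglyMeasurable.enorm
  have hv := hg.stronglyMeasurable.enorm
  have hU₀ : ∀ y ∉ H, ∫⁻ z, ‖f z‖ₑ * ‖g (z⁻¹ * y)‖ₑ ∂μ = 0 := fun y hy => by
    simp only [mul_inv_mul_eq_zero hf.enorm_eq_zero hg.enorm_eq_zero hy, lintegral_zero]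
  have hU_fin : ∫⁻ y, ∫⁻ z, ‖f z‖ₑ * ‖g (z⁻¹ * y)‖ₑ ∂μ ∂μ ≠ ∞ := by
    rw [lintegral_lintegral_mul_inv_mul hH hHc hu hv hf.enorm_eq_zero hg.enorm_eq_zero]
    exact ENNReal.mul_ne_top hf.integrable.2.ne hg.integrable.2.ne
  filter_upwards [ae_lintegral_mul_inv_mul_lt_top hH hHc
    (measurable_lintegral_mul_inv_mul hH hHc hu hv hf.enorm_eq_zero) hh.stronglyMeasurable.enorm
    hU₀ hh.enorm_eq_zero hU_fin hh.integrable.2.ne] with x hx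
  refine ne_top_of_le_ne_top hx.ne (lintegral_mono fun y => ?_)
  have hm : Measurable fun z => ‖f z‖ₑ * ‖g (z⁻¹ * y)‖ₑ :=
    hu.mul (hv.comp (measurable_inv.mul_const y))
  rw [← lintegral_mul_const _ hm]
  exact lintegral_mono fun z => T.enorm_convConvIntegrand_le f g h x y z

variable [CompleteSpace B]

theorem conv_conv_left_eq_integral (h : G → B) (x : G) :
    T.conv μ (T.conv μ f g) h x = ∫ y, ∫ z, T.convConvIntegrand f g h x y z ∂μ ∂μ := by
  refine integral_congr_ae ?_
  filter_upwards [T.ae_integrable_convIntegrand hH hHc hf hg] with y hy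
  exact ((T.fiberMulLeft y (y⁻¹ * x) (h (y⁻¹ * x))).integral_comp_comm hy).symm

variable [LocallyCompactSpace G]

theorem conv_conv_right_eq_integral (h : G → B) (x : G) :
    T.conv μ h (T.conv μ f g) x = ∫ z, ∫ y, T.convConvIntegrand h f g x y z ∂μ ∂μ := by
  refine integral_congr_ae ?_
  filter_upwards [(quasiMeasurePreserving_inv_mul_haar μ x).ae
    (T.ae_integrable_convIntegrand hH hHc hf hg)] with z hz
  rw [← integral_mul_left_eq_self _ z]
  simp only [convConvIntegrand_mul]
  exact ((T.fiberMulRight z (z⁻¹ * x) (h z)).integral_comp_comm hz).symm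

theorem conv_assoc_ae (hh : IsIntegrableIn μ H h) :
    T.conv μ (T.conv μ f g) h =ᵐ[μ] T.conv μ f (T.conv μ g h) := by
  filter_upwards [T.ae_lintegral_convConvIntegrand_ne_top hH hHc hf hg hh] with x hx
  rw [T.conv_conv_left_eq_integral hH hHc hf hg, T.conv_conv_right_eq_integral hH hHc hg hh]
  refine integral_integral_swap_of_support hH.measurableSet hHc
    (T.stronglyMeasurable_convConvIntegrand hH hHc hf hg hh x) (fun y hy z => ?_)
    (fun y z hz => ?_) hx
  · rw [convConvIntegrand, T.convIntegrand_eq_zero_of_left hf hg hy, fiberMul_zero_left]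
  · rw [convConvIntegrand, T.convIntegrand_eq_zero_of_right hf y hz, fiberMul_zero_left]

end Associativity

section Involution

variable [IsTopologicalGroup G] [LocallyCompactSpace G] [BorelSpace G]

theorem stronglyMeasurable_invol (hH : IsOpen (H : Set G)) (hHc : IsSigmaCompact (H : Set G))
    (hf : IsIntegrableIn μ H f) : StronglyMeasurable (T.invol f) := by
  have hmod : Continuous fun x : G => (modularCharacterFun x : ℂ) :=
    Complex.continuous_ofReal.comp continuous_modularCharacterFun
  have hstar : StronglyMeasurable fun x => T.fiberStar x (f x⁻¹) :=
    T.stronglyMeasurable_fiberStar hH hHc (p := fun x => x)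
      (BorelProd.continuous_mk continuous_id continuous_inv).measurable
      (hf.stronglyMeasurable.comp_measurable measurable_inv)
      fun x hx => hf.eq_zero _ fun h => hx ⟨H.inv_mem_iff.1 h, h⟩
  rw [funext (T.invol_eq_smul_fiberStar f)]
  exact hmod.measurable.stronglyMeasurable.smul hstar

variable [μ.IsHaarMeasure] [μ.Regular]

theorem invol_congr_ae {f' : G → B} (hf : f =ᵐ[μ] f') : T.invol f =ᵐ[μ] T.invol f' := by
  filter_upwards [(quasiMeasurePreserving_inv_haar μ).ae hf] with x hx
  rw [invol_eq_smul_fiberStar, invol_eq_smul_fiberStar, hx]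

variable (hH : IsOpen (H : Set G)) (hHc : IsSigmaCompact (H : Set G))
  (hf : IsIntegrableIn μ H f)

include hH hHc hf

theorem lintegral_enorm_invol_le : ∫⁻ x, ‖T.invol f x‖ₑ ∂μ ≤ ∫⁻ x, ‖f x‖ₑ ∂μ := by
  rw [← lintegral_modularCharacterFun_mul_inv hH hHc hf.stronglyMeasurable.enorm
    hf.enorm_eq_zero]
  exact lintegral_mono fun x => T.enorm_invol_le f x

theorem isIntegrableIn_invol : IsIntegrableIn μ H (T.invol f) where
  stronglyMeasurable := T.stronglyMeasurable_invol hH hHc hf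
  integrable := ⟨(T.stronglyMeasurable_invol hH hHc hf).aestronglyMeasurable,
    (T.lintegral_enorm_invol_le hH hHc hf).trans_lt hf.integrable.2⟩
  eq_zero x hx := by
    rw [invol_eq_smul_fiberStar, hf.eq_zero _ fun h => hx (H.inv_mem_iff.1 h), fiberStar_zero,
      smul_zero]

omit hH hHc hf

theorem invol_conv_ae [CompleteSpace B] (hH : IsOpen (H : Set G))
    (hHc : IsSigmaCompact (H : Set G)) (hf : IsIntegrableIn μ H f) (hg : IsIntegrableIn μ H g) :
    T.invol (T.conv μ f g) =ᵐ[μ] T.conv μ (T.invol g) (T.invol f) := by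
  filter_upwards [(quasiMeasurePreserving_inv_haar μ).ae
    (T.ae_integrable_convIntegrand hH hHc hf hg)] with x hx
  have hstar : T.fiberStar x (T.conv μ f g x⁻¹) =
      ∫ y, T.fiberMul y (y⁻¹ * x) (T.fiberStar y (g y⁻¹))
        (T.fiberStar (y⁻¹ * x) (f (y⁻¹ * x)⁻¹)) ∂μ := by
    rw [← integral_mul_left_eq_self _ x]
    simp only [← fiberStar_convIntegrand]
    exact ((T.fiberStarL x).integral_comp_comm hx).symm
  rw [invol_eq_smul_fiberStar, hstar]
  simp only [conv, convIntegrand_invol_invol, integral_smul]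

end Involution

end Functions

end TwistedAction

/-! ### The Banach `*`-algebra `L¹` -/

theorem IsIdentity.map_of_denseRange {A B : Type*} [Mul A] [NormedAddCommGroup B]
    [NormedSpace ℂ B] [Mul B] [Star B] (hB : IsBanachStarAlgebra B) {ι : A → B}
    (hmul : ∀ a b, ι (a * b) = ι a * ι b) (hdense : DenseRange ι) {e : A} (he : IsIdentity e) :
    IsIdentity (ι e) := by
  let := hB.toNonUnitalNormedRing
  have hl : (fun b => ι e * b) = id := hdense.equalizer (continuous_const_mul (ι e))
    continuous_id (funext fun a => (hmul e a).symm.trans (congrArg ι (he a).1))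
  have hr : (fun b => b * ι e) = id := hdense.equalizer (continuous_mul_const (ι e))
    continuous_id (funext fun a => (hmul a e).symm.trans (congrArg ι (he a).2))
  exact fun b => ⟨congrFun hl b, congrFun hr b⟩

section DenseRange

open scoped ENNReal

variable {X 𝕜 E F : Type*} [MeasurableSpace X] {μ : Measure X} {p : ℝ≥0∞}
  [NormedAddCommGroup E] [NormedAddCommGroup F] {s : Set X}

theorem continuous_indicatorConstLp [Fact (1 ≤ p)] (hs : MeasurableSet s) (hμs : μ s ≠ ∞) :
    Continuous fun c : E => indicatorConstLp p hs hμs c := by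
  refine (LipschitzWith.of_dist_le_mul (K := (μ.real s ^ (1 / p.toReal)).toNNReal)
    fun c d => ?_).continuous
  rw [dist_eq_norm, indicatorConstLp_sub, dist_eq_norm, Real.coe_toNNReal _ (by positivity),
    mul_comm]
  exact norm_indicatorConstLp_le

variable [NontriviallyNormedField 𝕜] [NormedSpace 𝕜 E] [NormedSpace 𝕜 F]

theorem compLp_indicatorConstLp (L : E →L[𝕜] F) (hs : MeasurableSet s) (hμs : μ s ≠ ∞) (c : E) :
    L.compLp (indicatorConstLp p hs hμs c) = indicatorConstLp p hs hμs (L c) := by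
  classical
  refine Lp.ext ?_
  filter_upwards [L.coeFn_compLp (indicatorConstLp p hs hμs c),
    indicatorConstLp_coeFn (p := p) (hs := hs) (hμs := hμs) (c := c),
    indicatorConstLp_coeFn (p := p) (hs := hs) (hμs := hμs) (c := L c)] with x hL hc hLc
  rw [hL, hc, hLc]
  exact (congrFun (Set.indicator_comp_of_zero (map_zero L)) x).symm

theorem denseRange_compLpL [Fact (1 ≤ p)] (hp : p ≠ ∞) {L : E →L[𝕜] F} (hL : DenseRange L) :
    DenseRange (L.compLpL p μ) := by
  let R := (LinearMap.range (L.compLpL p μ).toLinearMap).topologicalClosure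
  have hind : ∀ {s : Set X} (hs : MeasurableSet s) (hμs : μ s ≠ ∞) (c : F),
      indicatorConstLp p hs hμs c ∈ R := fun hs hμs c =>
    hL.induction_on (p := fun c => indicatorConstLp p hs hμs c ∈ R) c
      ((Submodule.isClosed_topologicalClosure _).preimage (continuous_indicatorConstLp hs hμs))
      fun a => Submodule.le_topologicalClosure _
        ⟨indicatorConstLp p hs hμs a, compLp_indicatorConstLp L hs hμs a⟩
  refine fun f => Lp.induction hp (motive := fun f => f ∈ R) (fun c s hs hμs => ?_)
    (fun f g hf hg _ hfR hgR => R.add_mem hfR hgR) (Submodule.isClosed_topologicalClosure _) f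
  rw [Lp.simpleFunc.coe_indicatorConst]
  exact hind hs hμs.ne c

end DenseRange

theorem IsIntegrableIn.map {G E F : Type*} [MeasurableSpace G] [NormedAddCommGroup E]
    [NormedSpace ℂ E] [NormedAddCommGroup F] [NormedSpace ℂ F] {μ : Measure G} {H : Set G}
    {f : G → E} (hf : IsIntegrableIn μ H f) (L : E →L[ℂ] F) :
    IsIntegrableIn μ H fun x => L (f x) where
  stronglyMeasurable := L.continuous.comp_stronglyMeasurable hf.stronglyMeasurable
  integrable := L.integrable_comp hf.integrable
  eq_zero x hx := by rw [hf.eq_zero x hx, map_zero]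

namespace TwistedAction

section L1

open scoped ENNReal

variable {G B : Type*} [Group G] [TopologicalSpace G] [MeasurableSpace G]
  [NonUnitalNormedRing B] [StarRing B] [NormedStarGroup B] [NormedSpace ℂ B]
  [IsScalarTower ℂ B B] [SMulCommClass ℂ B B] [StarModule ℂ B] {T : TwistedAction G B}
  {μ : Measure G}

namespace L1

theorem integrable_fn (Φ : T.L1 μ) : Integrable Φ.fn μ :=
  MeasureTheory.L1.integrable_coeFn (show Lp B 1 μ from Φ)

theorem ext {Φ Ψ : T.L1 μ} (h : Φ.fn =ᵐ[μ] Ψ.fn) : Φ = Ψ :=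
  Lp.ext (f := (show Lp B 1 μ from Φ)) (g := (show Lp B 1 μ from Ψ)) h

theorem fn_mk {f : G → B} (hf : Integrable f μ) : (L1.mk T μ f).fn =ᵐ[μ] f := by
  rw [L1.mk, dif_pos hf]
  exact hf.coeFn_toL1

theorem fn_add (Φ Ψ : T.L1 μ) : (Φ + Ψ).fn =ᵐ[μ] fun x => Φ.fn x + Ψ.fn x :=
  Lp.coeFn_add (show Lp B 1 μ from Φ) (show Lp B 1 μ from Ψ)

theorem fn_smul (z : ℂ) (Φ : T.L1 μ) : (z • Φ).fn =ᵐ[μ] fun x => z • Φ.fn x :=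
  Lp.coeFn_smul z (show Lp B 1 μ from Φ)

theorem norm_eq (Φ : T.L1 μ) : ‖Φ‖ = (∫⁻ x, ‖Φ.fn x‖ₑ ∂μ).toReal :=
  MeasureTheory.L1.norm_def (show Lp B 1 μ from Φ)

theorem ofReal_norm_eq (Φ : T.L1 μ) : ENNReal.ofReal ‖Φ‖ = ∫⁻ x, ‖Φ.fn x‖ₑ ∂μ := by
  rw [norm_eq, ENNReal.ofReal_toReal (integrable_fn Φ).2.ne]

theorem ofReal_norm_eq_of_ae_eq {Φ : T.L1 μ} {f : G → B} (h : Φ.fn =ᵐ[μ] f) :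
    ENNReal.ofReal ‖Φ‖ = ∫⁻ x, ‖f x‖ₑ ∂μ :=
  (ofReal_norm_eq Φ).trans (lintegral_congr_ae (h.fun_comp (‖·‖ₑ)))

theorem isIntegrableIn_fn {H : Set G} {Φ : T.L1 μ} (h : ∀ x ∉ H, Φ.fn x = 0) :
    IsIntegrableIn μ H Φ.fn :=
  ⟨Lp.stronglyMeasurable (show Lp B 1 μ from Φ), integrable_fn Φ, h⟩

variable [IsTopologicalGroup G] [LocallyCompactSpace G] [BorelSpace G] [μ.IsHaarMeasure]
  [μ.Regular]

theorem exists_isIntegrableIn (Φ Ψ Ξ : T.L1 μ) :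
    ∃ H : Subgroup G, IsOpen (H : Set G) ∧ IsSigmaCompact (H : Set G) ∧
      IsIntegrableIn μ H Φ.fn ∧ IsIntegrableIn μ H Ψ.fn ∧ IsIntegrableIn μ H Ξ.fn := by
  have hm : ∀ Φ : T.L1 μ, Measurable fun x => ‖Φ.fn x‖ₑ := fun Φ =>
    (Lp.stronglyMeasurable (show Lp B 1 μ from Φ)).enorm
  have hfin : ∫⁻ x, (‖Φ.fn x‖ₑ + ‖Ψ.fn x‖ₑ + ‖Ξ.fn x‖ₑ) ∂μ ≠ ∞ := by
    rw [lintegral_add_right _ (hm Ξ), lintegral_add_left (hm Φ)]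
    exact ENNReal.add_ne_top.2 ⟨ENNReal.add_ne_top.2
      ⟨(integrable_fn Φ).2.ne, (integrable_fn Ψ).2.ne⟩, (integrable_fn Ξ).2.ne⟩
  obtain ⟨H, hH, hHc, hzero⟩ :=
    exists_subgroup_of_lintegral_ne_top (((hm Φ).add (hm Ψ)).add (hm Ξ)) hfin
  have hfn : ∀ x ∉ H, (Φ.fn x = 0 ∧ Ψ.fn x = 0) ∧ Ξ.fn x = 0 := fun x hx => by
    have hx₀ : ‖Φ.fn x‖ₑ + ‖Ψ.fn x‖ₑ + ‖Ξ.fn x‖ₑ = 0 := hzero x hx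
    simpa only [add_eq_zero, enorm_eq_zero] using hx₀
  exact ⟨H, hH, hHc, isIntegrableIn_fn fun x hx => (hfn x hx).1.1,
    isIntegrableIn_fn fun x hx => (hfn x hx).1.2, isIntegrableIn_fn fun x hx => (hfn x hx).2⟩

variable (T μ) in
theorem operationsDefined : T.L1OperationsDefined μ where
  integrable_integrand Φ Ψ := by
    obtain ⟨H, hH, hHc, hΦ, hΨ, -⟩ := exists_isIntegrableIn Φ Ψ Ψ
    exact T.ae_integrable_convIntegrand hH hHc hΦ hΨ
  integrable_conv Φ Ψ := by
    obtain ⟨H, hH, hHc, hΦ, hΨ, -⟩ := exists_isIntegrableIn Φ Ψ Ψ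
    exact (T.isIntegrableIn_conv hH hHc hΦ hΨ).integrable
  integrable_invol Φ := by
    obtain ⟨H, hH, hHc, hΦ, -, -⟩ := exists_isIntegrableIn Φ Φ Φ
    exact (T.isIntegrableIn_invol hH hHc hΦ).integrable

theorem fn_mul (Φ Ψ : T.L1 μ) : (Φ * Ψ).fn =ᵐ[μ] T.conv μ Φ.fn Ψ.fn :=
  fn_mk ((operationsDefined T μ).integrable_conv Φ Ψ)

theorem fn_star (Φ : T.L1 μ) : (star Φ).fn =ᵐ[μ] T.invol Φ.fn :=
  fn_mk ((operationsDefined T μ).integrable_invol Φ)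

theorem fn_mul_congr {Φ Ψ : T.L1 μ} {f g : G → B} (hf : Φ.fn =ᵐ[μ] f) (hg : Ψ.fn =ᵐ[μ] g) :
    (Φ * Ψ).fn =ᵐ[μ] T.conv μ f g := by
  rw [← T.conv_congr_ae hf hg]
  exact fn_mul Φ Ψ

theorem fn_star_congr {Φ : T.L1 μ} {f : G → B} (hf : Φ.fn =ᵐ[μ] f) :
    (star Φ).fn =ᵐ[μ] T.invol f :=
  (fn_star Φ).trans (T.invol_congr_ae hf)

protected theorem mul_assoc [CompleteSpace B] (Φ Ψ Ξ : T.L1 μ) : Φ * Ψ * Ξ = Φ * (Ψ * Ξ) := by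
  obtain ⟨H, hH, hHc, hΦ, hΨ, hΞ⟩ := exists_isIntegrableIn Φ Ψ Ξ
  exact ext <| (fn_mul_congr (fn_mul Φ Ψ) .rfl).trans <|
    (T.conv_assoc_ae hH hHc hΦ hΨ hΞ).trans (fn_mul_congr .rfl (fn_mul Ψ Ξ)).symm

protected theorem add_mul (Φ Ψ Ξ : T.L1 μ) : (Φ + Ψ) * Ξ = Φ * Ξ + Ψ * Ξ := by
  have hint := (operationsDefined T μ).integrable_integrand
  refine ext ((fn_mul_congr (fn_add Φ Ψ) .rfl).trans ?_)
  filter_upwards [fn_add (Φ * Ξ) (Ψ * Ξ), fn_mul Φ Ξ, fn_mul Ψ Ξ, hint Φ Ξ, hint Ψ Ξ]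
    with x hadd hΦΞ hΨΞ hintΦ hintΨ
  rw [hadd, hΦΞ, hΨΞ, conv, conv, conv, ← integral_add hintΦ hintΨ]
  simp only [convIntegrand_eq_fiberMul, fiberMul_add_left]

protected theorem mul_add (Φ Ψ Ξ : T.L1 μ) : Φ * (Ψ + Ξ) = Φ * Ψ + Φ * Ξ := by
  have hint := (operationsDefined T μ).integrable_integrand
  refine ext ((fn_mul_congr .rfl (fn_add Ψ Ξ)).trans ?_)
  filter_upwards [fn_add (Φ * Ψ) (Φ * Ξ), fn_mul Φ Ψ, fn_mul Φ Ξ, hint Φ Ψ, hint Φ Ξ]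
    with x hadd hΦΨ hΦΞ hintΨ hintΞ
  rw [hadd, hΦΨ, hΦΞ, conv, conv, conv, ← integral_add hintΨ hintΞ]
  simp only [convIntegrand_eq_fiberMul, fiberMul_add_right]

protected theorem smul_mul (z : ℂ) (Φ Ψ : T.L1 μ) : (z • Φ) * Ψ = z • (Φ * Ψ) := by
  refine ext ((fn_mul_congr (fn_smul z Φ) .rfl).trans ?_)
  filter_upwards [fn_smul z (Φ * Ψ), fn_mul Φ Ψ] with x hsmul hmul
  rw [hsmul, hmul, conv, conv, ← integral_smul]
  simp only [convIntegrand_eq_fiberMul, fiberMul_smul_left]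

protected theorem mul_smul (z : ℂ) (Φ Ψ : T.L1 μ) : Φ * (z • Ψ) = z • (Φ * Ψ) := by
  refine ext ((fn_mul_congr .rfl (fn_smul z Ψ)).trans ?_)
  filter_upwards [fn_smul z (Φ * Ψ), fn_mul Φ Ψ] with x hsmul hmul
  rw [hsmul, hmul, conv, conv, ← integral_smul]
  simp only [convIntegrand_eq_fiberMul, fiberMul_smul_right]

protected theorem norm_mul_le (Φ Ψ : T.L1 μ) : ‖Φ * Ψ‖ ≤ ‖Φ‖ * ‖Ψ‖ := by
  obtain ⟨H, hH, hHc, hΦ, hΨ, -⟩ := exists_isIntegrableIn Φ Ψ Ψ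
  rw [← ENNReal.ofReal_le_ofReal_iff (by positivity), ENNReal.ofReal_mul (norm_nonneg _),
    ofReal_norm_eq_of_ae_eq (fn_mul Φ Ψ), ofReal_norm_eq, ofReal_norm_eq]
  exact T.lintegral_enorm_conv_le hH hHc hΦ hΨ

protected theorem star_star (Φ : T.L1 μ) : star (star Φ) = Φ := by
  refine ext ((fn_star_congr (fn_star Φ)).trans ?_)
  rw [invol_invol]

protected theorem star_mul [CompleteSpace B] (Φ Ψ : T.L1 μ) :
    star (Φ * Ψ) = star Ψ * star Φ := by
  obtain ⟨H, hH, hHc, hΦ, hΨ, -⟩ := exists_isIntegrableIn Φ Ψ Ψ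
  exact ext <| (fn_star_congr (fn_mul Φ Ψ)).trans <|
    (T.invol_conv_ae hH hHc hΦ hΨ).trans (fn_mul_congr (fn_star Ψ) (fn_star Φ)).symm

protected theorem star_add (Φ Ψ : T.L1 μ) : star (Φ + Ψ) = star Φ + star Ψ := by
  refine ext ((fn_star_congr (fn_add Φ Ψ)).trans ?_)
  filter_upwards [fn_add (star Φ) (star Ψ), fn_star Φ, fn_star Ψ] with x hadd hΦ hΨ
  rw [hadd, hΦ, hΨ, invol_eq_smul_fiberStar, invol_eq_smul_fiberStar, invol_eq_smul_fiberStar,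
    fiberStar_add, smul_add]

protected theorem star_smul (z : ℂ) (Φ : T.L1 μ) :
    star (z • Φ) = (starRingEnd ℂ z) • star Φ := by
  refine ext ((fn_star_congr (fn_smul z Φ)).trans ?_)
  filter_upwards [fn_smul (starRingEnd ℂ z) (star Φ), fn_star Φ] with x hsmul hstar
  rw [hsmul, hstar, invol_eq_smul_fiberStar, invol_eq_smul_fiberStar, fiberStar_smul, smul_comm]

theorem norm_star_le (Φ : T.L1 μ) : ‖star Φ‖ ≤ ‖Φ‖ := by
  obtain ⟨H, hH, hHc, hΦ, -, -⟩ := exists_isIntegrableIn Φ Φ Φ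
  rw [← ENNReal.ofReal_le_ofReal_iff (norm_nonneg _), ofReal_norm_eq_of_ae_eq (fn_star Φ),
    ofReal_norm_eq]
  exact T.lintegral_enorm_invol_le hH hHc hΦ

theorem isBanachStarAlgebra [CompleteSpace B] : IsBanachStarAlgebra (T.L1 μ) where
  complete := inferInstanceAs (CompleteSpace (Lp B 1 μ))
  mul_assoc := L1.mul_assoc
  add_mul := L1.add_mul
  mul_add := L1.mul_add
  smul_mul := L1.smul_mul
  mul_smul := L1.mul_smul
  norm_mul_le := L1.norm_mul_le
  star_star := L1.star_star
  star_mul := L1.star_mul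
  star_add := L1.star_add
  star_smul := L1.star_smul
  norm_star Φ := (norm_star_le Φ).antisymm <|
    (congrArg norm (L1.star_star Φ)).ge.trans (norm_star_le (star Φ))

end L1

end L1

section Inclusion

variable {G A B : Type*} [Group G] [TopologicalSpace G]
  [NonUnitalNormedRing A] [StarRing A] [NormedStarGroup A] [NormedSpace ℂ A]
  [IsScalarTower ℂ A A] [SMulCommClass ℂ A A] [StarModule ℂ A]
  [NonUnitalNormedRing B] [StarRing B] [NormedStarGroup B] [NormedSpace ℂ B]
  [IsScalarTower ℂ B B] [SMulCommClass ℂ B B] [StarModule ℂ B]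
  {S : TwistedAction G A} {T : TwistedAction G B} {ι : A →L[ℂ] B}

theorem enorm_convIntegrand_le_of_norm_mul_le {C : ℝ} (hC : 0 ≤ C)
    (hdiff : ∀ a b : A, ‖a * b‖ ≤ C * (‖a‖ * ‖ι b‖ + ‖ι a‖ * ‖b‖)) (hST : T.RestrictsTo ι S)
    (f g : G → A) (x y : G) :
    ‖S.convIntegrand f g x y‖ₑ ≤ ENNReal.ofReal C *
      (‖f y‖ₑ * ‖ι (g (y⁻¹ * x))‖ₑ + ‖ι (f y)‖ₑ * ‖g (y⁻¹ * x)‖ₑ) := by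
  simp only [← ofReal_norm]
  rw [← ENNReal.ofReal_mul (norm_nonneg _), ← ENNReal.ofReal_mul (norm_nonneg _),
    ← ENNReal.ofReal_add (by positivity) (by positivity), ← ENNReal.ofReal_mul hC]
  refine ENNReal.ofReal_le_ofReal ?_
  calc ‖S.convIntegrand f g x y‖ ≤ ‖f y * S.α y (g (y⁻¹ * x))‖ :=
        (S.unitary_ω _ _).norm_snd_le _
    _ ≤ _ := hdiff _ _
    _ = _ := by rw [hST.map_α, T.norm_α, S.norm_α]

variable [MeasurableSpace G] {μ : Measure G}

theorem fn_L1incl (Φ : S.L1 μ) : (L1incl S T μ ι Φ).fn =ᵐ[μ] fun x => ι (Φ.fn x) :=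
  ι.coeFn_compLpL (show Lp A 1 μ from Φ)

theorem L1incl_injective (hι : Function.Injective ι) :
    Function.Injective (L1incl S T μ ι) := fun Φ Ψ h => by
  refine L1.ext ?_
  have hΦ := fn_L1incl (T := T) (ι := ι) Φ
  rw [h] at hΦ
  filter_upwards [hΦ, fn_L1incl (T := T) (ι := ι) Ψ] with x hΦx hΨx
  exact hι (hΦx.symm.trans hΨx)

theorem denseRange_L1incl (hι : DenseRange ι) : DenseRange (L1incl S T μ ι) :=
  denseRange_compLpL ENNReal.one_ne_top hι

variable [IsTopologicalGroup G] [BorelSpace G] [μ.IsHaarMeasure] [μ.Regular]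

theorem lintegral_enorm_conv_le_of_norm_mul_le {C : ℝ} (hC : 0 ≤ C)
    (hdiff : ∀ a b : A, ‖a * b‖ ≤ C * (‖a‖ * ‖ι b‖ + ‖ι a‖ * ‖b‖)) (hST : T.RestrictsTo ι S)
    {H : Subgroup G} (hH : IsOpen (H : Set G)) (hHc : IsSigmaCompact (H : Set G))
    {f g : G → A} (hf : IsIntegrableIn μ H f) (hg : IsIntegrableIn μ H g) :
    ∫⁻ x, ‖S.conv μ f g x‖ₑ ∂μ ≤ ENNReal.ofReal C *
      ((∫⁻ x, ‖f x‖ₑ ∂μ) * (∫⁻ x, ‖ι (g x)‖ₑ ∂μ) +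
        (∫⁻ x, ‖ι (f x)‖ₑ ∂μ) * ∫⁻ x, ‖g x‖ₑ ∂μ) := by
  have hιf := hf.map ι
  have hιg := hg.map ι
  have hfm := hf.stronglyMeasurable.enorm
  have hgm := hg.stronglyMeasurable.enorm
  have hιfm := hιf.stronglyMeasurable.enorm
  have hιgm := hιg.stronglyMeasurable.enorm
  have hm : ∀ x, Measurable fun y => ‖f y‖ₑ * ‖ι (g (y⁻¹ * x))‖ₑ := fun x =>
    hfm.mul (hιgm.comp (measurable_inv.mul_const x))
  calc ∫⁻ x, ‖S.conv μ f g x‖ₑ ∂μ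
      ≤ ∫⁻ x, ∫⁻ y, ENNReal.ofReal C * (‖f y‖ₑ * ‖ι (g (y⁻¹ * x))‖ₑ +
          ‖ι (f y)‖ₑ * ‖g (y⁻¹ * x)‖ₑ) ∂μ ∂μ :=
        lintegral_mono fun x => (enorm_integral_le_lintegral_enorm _).trans <|
          lintegral_mono fun y => enorm_convIntegrand_le_of_norm_mul_le hC hdiff hST f g x y
    _ = ENNReal.ofReal C * (∫⁻ x, ∫⁻ y, ‖f y‖ₑ * ‖ι (g (y⁻¹ * x))‖ₑ ∂μ ∂μ +
          ∫⁻ x, ∫⁻ y, ‖ι (f y)‖ₑ * ‖g (y⁻¹ * x)‖ₑ ∂μ ∂μ) := by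
        rw [← lintegral_add_left (measurable_lintegral_mul_inv_mul hH hHc hfm hιgm
          hf.enorm_eq_zero), ← lintegral_const_mul' _ _ ENNReal.ofReal_ne_top]
        simp only [lintegral_const_mul' _ _ ENNReal.ofReal_ne_top, lintegral_add_left (hm _)]
    _ = _ := by
        rw [lintegral_lintegral_mul_inv_mul hH hHc hfm hιgm hf.enorm_eq_zero hιg.enorm_eq_zero,
          lintegral_lintegral_mul_inv_mul hH hHc hιfm hgm hιf.enorm_eq_zero hg.enorm_eq_zero]

variable [LocallyCompactSpace G]

theorem L1incl_mul [CompleteSpace A] [CompleteSpace B]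
    (hmul : ∀ a b : A, ι (a * b) = ι a * ι b) (hST : T.RestrictsTo ι S)
    (Φ Ψ : S.L1 μ) : L1incl S T μ ι (Φ * Ψ) = L1incl S T μ ι Φ * L1incl S T μ ι Ψ := by
  refine L1.ext ((fn_L1incl _).trans
    (Filter.EventuallyEq.trans ?_ (L1.fn_mul_congr (fn_L1incl Φ) (fn_L1incl Ψ)).symm))
  filter_upwards [L1.fn_mul Φ Ψ, (L1.operationsDefined S μ).integrable_integrand Φ Ψ]
    with x hconv hint
  rw [hconv, conv, conv, ← ι.integral_comp_comm hint]
  simp only [convIntegrand_eq_fiberMul, hST.map_fiberMul hmul]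

theorem L1incl_star (hstar : ∀ a : A, ι (star a) = star (ι a)) (hST : T.RestrictsTo ι S)
    (Φ : S.L1 μ) : L1incl S T μ ι (star Φ) = star (L1incl S T μ ι Φ) := by
  refine L1.ext ((fn_L1incl _).trans
    (Filter.EventuallyEq.trans ?_ (L1.fn_star_congr (fn_L1incl Φ)).symm))
  filter_upwards [L1.fn_star Φ] with x hinvol
  rw [hinvol, invol_eq_smul_fiberStar, invol_eq_smul_fiberStar, map_smul,
    hST.map_fiberStar hstar]

theorem norm_L1_mul_le {C : ℝ} (hC : 0 ≤ C)
    (hdiff : ∀ a b : A, ‖a * b‖ ≤ C * (‖a‖ * ‖ι b‖ + ‖ι a‖ * ‖b‖)) (hST : T.RestrictsTo ι S)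
    (Φ Ψ : S.L1 μ) :
    ‖Φ * Ψ‖ ≤ C * (‖Φ‖ * ‖L1incl S T μ ι Ψ‖ + ‖L1incl S T μ ι Φ‖ * ‖Ψ‖) := by
  obtain ⟨H, hH, hHc, hΦ, hΨ, -⟩ := L1.exists_isIntegrableIn Φ Ψ Ψ
  rw [← ENNReal.ofReal_le_ofReal_iff (by positivity), ENNReal.ofReal_mul hC,
    ENNReal.ofReal_add (by positivity) (by positivity), ENNReal.ofReal_mul (norm_nonneg _),
    ENNReal.ofReal_mul (norm_nonneg _), L1.ofReal_norm_eq_of_ae_eq (L1.fn_mul Φ Ψ),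
    L1.ofReal_norm_eq_of_ae_eq (fn_L1incl Φ), L1.ofReal_norm_eq_of_ae_eq (fn_L1incl Ψ),
    L1.ofReal_norm_eq, L1.ofReal_norm_eq]
  exact lintegral_enorm_conv_le_of_norm_mul_le hC hdiff hST hH hHc hΦ hΨ

theorem isDifferentialSubalgebra_L1incl (hdiff : IsDifferentialSubalgebra ι)
    (hdense : DenseRange ι) (hST : T.RestrictsTo ι S) :
    IsDifferentialSubalgebra (L1incl S T μ ι) := by
  have := hdiff.banach_left.complete
  have := hdiff.banach_right.complete
  obtain ⟨C, hC, hnorm⟩ := hdiff.norm_mul_le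
  exact
    { banach_left := L1.isBanachStarAlgebra
      banach_right := L1.isBanachStarAlgebra
      injective := L1incl_injective hdiff.injective
      map_mul := L1incl_mul hdiff.map_mul hST
      map_star := L1incl_star hdiff.map_star hST
      map_identity := fun _ he => he.map_of_denseRange L1.isBanachStarAlgebra
        (L1incl_mul hdiff.map_mul hST) (denseRange_L1incl hdense)
      norm_mul_le := ⟨C, hC, norm_L1_mul_le hC.le hnorm hST⟩ }

end Inclusion

end TwistedAction

theorem lemma2p6_general {G A B : Type*}
    [Group G] [TopologicalSpace G] [IsTopologicalGroup G] [LocallyCompactSpace G]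
    [MeasurableSpace G] [BorelSpace G]
    (μ : Measure G) [μ.IsHaarMeasure] [μ.Regular]
    [NonUnitalNormedRing A] [StarRing A] [NormedStarGroup A] [NormedSpace ℂ A]
    [IsScalarTower ℂ A A] [SMulCommClass ℂ A A] [StarModule ℂ A]
    [NonUnitalNormedRing B] [StarRing B] [NormedStarGroup B] [NormedSpace ℂ B]
    [IsScalarTower ℂ B B] [SMulCommClass ℂ B B] [StarModule ℂ B]
    (T : TwistedAction G B) (ι : A →L[ℂ] B)
    (hdiff : IsDifferentialSubalgebra ι) (hdense : DenseRange ι)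
    (S : TwistedAction G A) (hstable : T.RestrictsTo ι S) :
    S.L1OperationsDefined μ ∧ T.L1OperationsDefined μ ∧
      IsDifferentialSubalgebra (TwistedAction.L1incl S T μ ι) ∧
      DenseRange (TwistedAction.L1incl S T μ ι) ∧
      IsInverseClosed (TwistedAction.L1incl S T μ ι) :=
  have hdiffL1 := TwistedAction.isDifferentialSubalgebra_L1incl hdiff hdense hstable
  have hdenseL1 := TwistedAction.denseRange_L1incl hdense
  ⟨TwistedAction.L1.operationsDefined S μ, TwistedAction.L1.operationsDefined T μ, hdiffL1,
    hdenseL1, hdiffL1.isInverseClosed hdenseL1⟩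

theorem lemma2p6 {G A B : Type*}
    [Group G] [TopologicalSpace G] [IsTopologicalGroup G] [LocallyCompactSpace G] [T2Space G]
    [MeasurableSpace G] [BorelSpace G]
    (μ : Measure G) [μ.IsHaarMeasure] [μ.Regular]
    [NonUnitalNormedRing A] [StarRing A] [NormedStarGroup A] [NormedSpace ℂ A]
    [IsScalarTower ℂ A A] [SMulCommClass ℂ A A] [StarModule ℂ A] [CompleteSpace A]
    [NonUnitalNormedRing B] [StarRing B] [NormedStarGroup B] [NormedSpace ℂ B]
    [IsScalarTower ℂ B B] [SMulCommClass ℂ B B] [StarModule ℂ B] [CompleteSpace B]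
    (T : TwistedAction G B) (ι : A →L[ℂ] B)
    (hdiff : IsDifferentialSubalgebra ι) (hdense : DenseRange ι)
    (S : TwistedAction G A) (hstable : T.RestrictsTo ι S) :
    S.L1OperationsDefined μ ∧ T.L1OperationsDefined μ ∧
      IsDifferentialSubalgebra (TwistedAction.L1incl S T μ ι) ∧
      DenseRange (TwistedAction.L1incl S T μ ι) ∧
      IsInverseClosed (TwistedAction.L1incl S T μ ι) :=
  lemma2p6_general μ T ι hdiff hdense S hstable
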